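/- Consider a cellular network in the plane whose base stations (BSs) form a homogeneous Poisson point process $\Phi=\{x_k\}$ on $\mathbb{R}^2$ of intensity $\lambda>0$, and a typical user located at the origin. Let $C>0$, $\alpha>2$, $\Gamma_{cs}>0$, and let $l(r)=C r^{\alpha}$ be the path loss at distance $r$. For an integer $M\ge 1$ (the number of BS beams), divide the plane into the $M$ sectors $S_M(i)=\{x:\angle x\in[2\pi (i-1)/M,\,2\pi i/M)\}$, $1\le i\le M$. In cycle $n=1,2,\dots$ the link from BS $x_k$ to the user has fading $F_{n,k}$; the variables $(F_{n,k})_{n,k}$ are i.i.d. exponential with unit mean and independent of $\Phi$. Let $k_i$ be the index of the BS in $\Phi\cap S_M(i)$ with the smallest path loss to the user (the closest one). In the interference-limited scenario (no noise), sector $i$ is detected in cycle $n$ if $$\frac{F_{n,k_i}/l(\|x_{k_i}\|)}{\sum_{j\ne k_i,\ x_j\in S_M(i)}F_{n,j}/l(\|x_j\|)}>\Gamma_{cs},$$ and cycle $n$ succeeds if at least one of the $M$ sectors is detected in it. Let $L_{cs}(M)=\inf\{n\ge 1:\text{cycle } n \text{ succeeds}\}\in\{1,2,\dots\}\cup\{\infty\}$.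 **Lemma.** (1) If $M>\frac{2\Gamma_{cs}}{\alpha-2}$, then $\mathbb{E}[L_{cs}(M)]<\infty$; more precisely $$\mathbb{E}[L_{cs}(M)]\le \frac{M(\alpha-2)}{M(\alpha-2)-2\Gamma_{cs}}.$$ (2) For $M=1$, $\mathbb{E}[L_{cs}(1)]<\infty$ if and only if $\alpha>2\Gamma_{cs}+2$. -/

import Mathlib

open MeasureTheory ProbabilityTheory
open scoped ENNReal NNReal

namespace CellSearch

noncomputable section

/-- The counting measure `∑ k, δ_{X k ω}` of the (enumerated) random points `X 0, X 1, …`, so that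
`pointMeasure X ω A` is the number of points in the measurable set `A`. -/
def pointMeasure {Ω E : Type*} [MeasurableSpace E] (X : ℕ → Ω → E) (ω : Ω) : Measure E :=
  Measure.sum fun k => Measure.dirac (X k ω)

/-- The random points `X 0, X 1, …` form a Poisson point process with intensity measure `μ`:
the number of points in a measurable set `A` with `μ A < ∞` is Poisson distributed with mean `μ A`,
and the numbers of points in finitely many pairwise disjoint measurable sets are independent. -/
structure IsPoissonPointProcess {Ω E : Type*} [MeasurableSpace Ω] [MeasurableSpace E]
    (X : ℕ → Ω → E) (μ : Measure E) (P : Measure Ω) : Prop where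
  measurable : ∀ k, Measurable (X k)
  hasLaw : ∀ A : Set E, MeasurableSet A → μ A < ∞ →
    HasLaw (fun ω => pointMeasure X ω A)
      ((poissonMeasure (μ A).toNNReal).map (Nat.cast : ℕ → ℝ≥0∞)) P
  indep : ∀ (m : ℕ) (A : Fin m → Set E), (∀ i, MeasurableSet (A i)) →
    Pairwise (Function.onFun Disjoint A) →
    iIndepFun (fun i ω => pointMeasure X ω (A i)) P

/-- Rayleigh fading: the power fading `F n k` of the link to base station `k` in cycle `n` is
exponentially distributed with unit mean, independently over all links and all cycles. -/
structure IsRayleighFading {Ω : Type*} [MeasurableSpace Ω]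
    (F : ℕ → ℕ → Ω → ℝ) (P : Measure Ω) : Prop where
  measurable : ∀ n k, Measurable (F n k)
  hasLaw : ∀ n k, HasLaw (F n k) (expMeasure 1) P
  indep : iIndepFun (fun p : ℕ × ℕ => F p.1 p.2) P

/-- The single-slope path loss `l(r) = C r ^ α`. -/
def pathLoss (C α r : ℝ) : ℝ := C * r ^ α

/-- The polar angle in `[0, 2π)` of a point of the plane, which is identified with `ℂ`. -/
def angle (z : ℂ) : ℝ := if 0 ≤ z.arg then z.arg else z.arg + 2 * Real.pi

/-- The base station sectors seen from the origin: sector `i` (`i = 0, …, M - 1`) consists of the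
points whose polar angle lies in `[2π i / M, 2π (i + 1) / M)`. -/
def sector (M : ℕ) (i : Fin M) : Set ℂ :=
  {z | angle z ∈ Set.Ico (2 * Real.pi * (i : ℕ) / M) (2 * Real.pi * ((i : ℕ) + 1) / M)}

/-- For base station locations `x : ℕ → ℂ` and the path loss function `l`, station `k` lies in the
set `S` and provides the smallest path loss to the origin among all stations in `S`. -/
def IsBest (l : ℝ → ℝ) (x : ℕ → ℂ) (S : Set ℂ) (k : ℕ) : Prop :=
  x k ∈ S ∧ ∀ j, x j ∈ S → l ‖x k‖ ≤ l ‖x j‖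

/-- The power, divided by the transmit power and the antenna gain, that a user at the origin
receives from station `k`, when the fading variables are `f`. -/
def rxPower (l : ℝ → ℝ) (x : ℕ → ℂ) (f : ℕ → ℝ) (k : ℕ) : ℝ≥0∞ :=
  ENNReal.ofReal (f k) / ENNReal.ofReal (l ‖x k‖)

open scoped Classical in
/-- The signal-to-interference-plus-noise ratio at the origin of the signal of station `k`, when
exactly the stations in `S` are heard; `w` is the noise power divided by the transmit power and
the antenna gain. -/
def sinr (l : ℝ → ℝ) (w : ℝ≥0∞) (x : ℕ → ℂ) (f : ℕ → ℝ) (S : Set ℂ) (k : ℕ) : ℝ≥0∞ :=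
  rxPower l x f k / ((∑' j, if j ≠ k ∧ x j ∈ S then rxPower l x f j else 0) + w)

/-- The set `S` is detected: the SINR of its station with smallest path loss exceeds `Γ`. -/
def Detected (l : ℝ → ℝ) (w : ℝ≥0∞) (Γ : ℝ) (x : ℕ → ℂ) (f : ℕ → ℝ) (S : Set ℂ) : Prop :=
  ∃ k, IsBest l x S k ∧ ENNReal.ofReal Γ < sinr l w x f S k

/-- Cell search succeeds in a cycle: at least one of the `M` sectors is detected. -/
def Success (l : ℝ → ℝ) (w : ℝ≥0∞) (Γ : ℝ) (M : ℕ) (x : ℕ → ℂ) (f : ℕ → ℝ) : Prop :=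
  ∃ i : Fin M, Detected l w Γ x f (sector M i)

/-- The number `inf {n ≥ 1 : cycle n succeeds}` of initial access cycles needed to succeed in cell
search (`∞` if no cycle succeeds), where `f n` are the fading variables in cycle `n`. -/
def numCycles (l : ℝ → ℝ) (w : ℝ≥0∞) (Γ : ℝ) (M : ℕ) (x : ℕ → ℂ) (f : ℕ → ℕ → ℝ) : ℕ∞ :=
  ⨅ (n : ℕ) (_ : 1 ≤ n ∧ Success l w Γ M x (f n)), (n : ℕ∞)

/-- The expected number of initial access cycles in the interference-limited scenario (no noise)
with the single-slope path loss `l(r) = C r ^ α`. -/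
def meanCycles {Ω : Type*} [MeasurableSpace Ω] (P : Measure Ω) (X : ℕ → Ω → ℂ)
    (F : ℕ → ℕ → Ω → ℝ) (C α Γ : ℝ) (M : ℕ) : ℝ≥0∞ :=
  ∫⁻ ω, (numCycles (pathLoss C α) 0 Γ M (fun k => X k ω) (fun n k => F n k ω) : ℝ≥0∞) ∂P

end

end CellSearch

namespace CellSearch

noncomputable section

open Filter Topology

/-! ### Exponential and logarithm on `[0, ∞]`, and the conditional law of the number of cycles -/

section

/-! Conditionally on the stations the cycles are i.i.d. trials, so the mean number of cycles is the
expectation of `1/p`, with `p` the conditional success probability (`meanCycles_eq`). For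
exponential fading, a set served by its closest station `k` is detected with probability `∏ (1 +
c_j)⁻¹`, where `c_j = Γ (‖x_k‖/‖x_j‖)^α` over the interferers (`fadingLaw_sinr`). The Poisson
generating functional, `E ∏ (1 + g(x)) = exp ∫ g dμ` (`lintegral_prod_expE`), then makes the
expectation computable. Infinite products are written as `expE` of a sum of `logOneAdd`, with values
in `[0, ∞]`, so that no convergence conditions arise.

Upper bound: keep only the sector of the globally closest station. If that station is at distance
`r` and `t = λπr²`, the interferers of its sector contribute `exp(bt)` with `b = 2Γ/(M(α-2))`. Since
`t` is exponential with mean one, the bound is `∫ exp(-t) exp(bt) dt = 1/(1-b)`. Conditioning on `r`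
is replaced by cutting the plane into shells of mean count `δ`, which gives a geometric series, and
letting `δ → 0`.

Lower bound for `M = 1`: there is no choice of sector, and `α ≤ 2Γ + 2` means `b ≥ 1`. On the
disjoint events "the closest station is alone in the `m`-th shell of mean count one", `1/p`
contributes at least `exp(-α/2)` for every `m`, so the expectation diverges. -/

/-- The exponential function on `[0, ∞]`. -/
def expE (t : ℝ≥0∞) : ℝ≥0∞ := EReal.exp t

/-- The function `c ↦ log (1 + c)` on `[0, ∞]`. -/
def logOneAdd (c : ℝ≥0∞) : ℝ≥0∞ := (ENNReal.log (1 + c)).toENNReal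

@[simp] lemma expE_zero : expE 0 = 1 := by simp [expE]

@[simp] lemma logOneAdd_zero : logOneAdd 0 = 0 := by simp [logOneAdd]

lemma expE_add (s t : ℝ≥0∞) : expE (s + t) = expE s * expE t := by
  simp [expE, EReal.exp_add]

lemma expE_mono : Monotone expE := fun _ _ h => EReal.exp_monotone (by exact_mod_cast h)

lemma continuous_expE : Continuous expE :=
  ENNReal.continuous_exp.comp continuous_coe_ennreal_ereal

lemma expE_ofReal {t : ℝ} (ht : 0 ≤ t) : expE (ENNReal.ofReal t) = ENNReal.ofReal (Real.exp t) := by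
  rw [expE, EReal.coe_ennreal_ofReal, max_eq_left ht, EReal.exp_coe]

lemma one_le_expE (t : ℝ≥0∞) : 1 ≤ expE t := by
  simpa using expE_mono (zero_le (a := t))

lemma expE_ne_zero (t : ℝ≥0∞) : expE t ≠ 0 := (zero_lt_one.trans_le (one_le_expE t)).ne'

lemma expE_sum {ι : Type*} (s : Finset ι) (f : ι → ℝ≥0∞) :
    expE (∑ i ∈ s, f i) = ∏ i ∈ s, expE (f i) := by
  classical
  induction s using Finset.induction_on with
  | empty => simp
  | insert a s ha ih => rw [Finset.sum_insert ha, Finset.prod_insert ha, expE_add, ih]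

lemma expE_natCast_mul (n : ℕ) (t : ℝ≥0∞) : expE (n * t) = expE t ^ n := by
  induction n with
  | zero => simp
  | succ n ih => rw [Nat.cast_succ, add_mul, one_mul, expE_add, ih, pow_succ]

lemma expE_logOneAdd (c : ℝ≥0∞) : expE (logOneAdd c) = 1 + c := by
  rw [expE, logOneAdd, EReal.coe_toENNReal (by simp), ENNReal.exp_log]

lemma continuous_logOneAdd : Continuous logOneAdd :=
  EReal.continuous_toENNReal.comp (ENNReal.continuous_log.comp (by fun_prop))

lemma measurable_expE : Measurable expE := continuous_expE.measurable

lemma measurable_logOneAdd : Measurable logOneAdd := continuous_logOneAdd.measurable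

lemma logOneAdd_mono : Monotone logOneAdd := fun _ _ h =>
  EReal.toENNReal_le_toENNReal (ENNReal.log_le_log (by gcongr))

/-- The law of the fading variables of one cycle. -/
def fadingLaw : Measure (ℕ → ℝ) := Measure.infinitePi fun _ => expMeasure 1

instance : IsProbabilityMeasure (expMeasure 1) := isProbabilityMeasure_expMeasure one_pos

instance : IsProbabilityMeasure fadingLaw := by unfold fadingLaw; infer_instance

/-- Tail-sum formula: it turns a mean into a sum of tail probabilities, including the value `∞`. -/
lemma natCast_tsum (m : ℕ∞) : (m : ℝ≥0∞) = ∑' n : ℕ, if (n : ℕ∞) < m then 1 else 0 := by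
  induction m using ENat.recTopCoe with
  | top => simp
  | coe m =>
    rw [tsum_eq_sum (s := Finset.range m)]
    · rw [Finset.sum_congr rfl (g := fun _ => (1 : ℝ≥0∞))]
      · simp
      · intro n hn
        simp_all
    · intro n hn
      simp_all

lemma natCast_lt_iInf_iff (A : ℕ → Prop) (n : ℕ) :
    (n : ℕ∞) < (⨅ (i : ℕ) (_ : 1 ≤ i ∧ A i), (i : ℕ∞)) ↔ ∀ i ∈ Finset.Icc 1 n, ¬ A i := by
  constructor
  · intro h i hi hA
    rw [Finset.mem_Icc] at hi
    have h1 : (⨅ (i : ℕ) (_ : 1 ≤ i ∧ A i), (i : ℕ∞)) ≤ (i : ℕ∞) := iInf₂_le i ⟨hi.1, hA⟩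
    have h2 : (i : ℕ∞) ≤ n := by exact_mod_cast hi.2
    exact absurd h (not_lt.mpr (h1.trans h2))
  · intro h
    have : ((n + 1 : ℕ) : ℕ∞) ≤ ⨅ (i : ℕ) (_ : 1 ≤ i ∧ A i), (i : ℕ∞) := by
      refine le_iInf₂ fun i hi => ?_
      by_contra hlt
      push Not at hlt
      have : i < n + 1 := by exact_mod_cast hlt
      exact h i (Finset.mem_Icc.mpr ⟨hi.1, by omega⟩) hi.2
    refine lt_of_lt_of_le ?_ this
    exact_mod_cast Nat.lt_succ_self n

/-- The mean of a geometric waiting time. -/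
lemma lintegral_waitingTime {Ω E : Type*} [MeasurableSpace Ω] [MeasurableSpace E]
    {P : Measure Ω} [IsProbabilityMeasure P] {G : ℕ → Ω → E} {ν : Measure E}
    [IsProbabilityMeasure ν] (hGm : ∀ n, Measurable (G n)) (hG : iIndepFun G P)
    (hlaw : ∀ n, P.map (G n) = ν) {A : Set E} (hA : MeasurableSet A) :
    ∫⁻ ω, ((⨅ (i : ℕ) (_ : 1 ≤ i ∧ G i ω ∈ A), (i : ℕ∞) : ℕ∞) : ℝ≥0∞) ∂P = (ν A)⁻¹ := by
  have hset (n : ℕ) : {ω | (n : ℕ∞) < ⨅ (i : ℕ) (_ : 1 ≤ i ∧ G i ω ∈ A), (i : ℕ∞)}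
      = ⋂ i ∈ Finset.Icc 1 n, G i ⁻¹' Aᶜ := by
    ext ω
    simp only [Set.mem_ofPred_eq, natCast_lt_iInf_iff]
    simp
  have hmeas (n : ℕ) : MeasurableSet (⋂ i ∈ Finset.Icc 1 n, G i ⁻¹' Aᶜ) :=
    Finset.measurableSet_biInter _ fun i _ => hGm i hA.compl
  have hprob (n : ℕ) : P (⋂ i ∈ Finset.Icc 1 n, G i ⁻¹' Aᶜ) = (1 - ν A) ^ n := by
    rw [hG.meas_biInter fun i _ => ⟨Aᶜ, hA.compl, rfl⟩]
    rw [Finset.prod_congr rfl (g := fun _ => 1 - ν A)]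
    · simp
    · intro i _
      rw [← Measure.map_apply (hGm i) hA.compl, hlaw, prob_compl_eq_one_sub hA]
  simp_rw [natCast_tsum]
  have hind (n : ℕ) (ω : Ω) :
      (if (n : ℕ∞) < ⨅ (i : ℕ) (_ : 1 ≤ i ∧ G i ω ∈ A), (i : ℕ∞) then (1 : ℝ≥0∞) else 0)
        = (⋂ i ∈ Finset.Icc 1 n, G i ⁻¹' Aᶜ).indicator 1 ω := by
    rw [← hset]
    simp [Set.indicator_apply]
  simp_rw [hind]
  rw [lintegral_tsum fun n => (measurable_one.indicator (hmeas n)).aemeasurable]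
  simp_rw [lintegral_indicator_one (hmeas _), hprob]
  -- The tails are `(1 - p)^n` from `n = 0` on. The case `p = 0` is covered by `0⁻¹ = ∞`.
  rw [ENNReal.tsum_geometric, ENNReal.sub_sub_cancel ENNReal.one_ne_top prob_le_one]

lemma measurable_angle : Measurable angle :=
  Measurable.ite (measurableSet_le measurable_const Complex.measurable_arg)
    Complex.measurable_arg (Complex.measurable_arg.add_const _)

lemma measurableSet_sector (M : ℕ) (i : Fin M) : MeasurableSet (sector M i) :=
  measurable_angle measurableSet_Ico

lemma measurable_pathLoss (C α : ℝ) : Measurable (pathLoss C α) := by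
  unfold pathLoss; fun_prop

lemma measurableSet_success {l : ℝ → ℝ} (hl : Measurable l) (w : ℝ≥0∞) (Γ : ℝ) (M : ℕ) :
    MeasurableSet {p : (ℕ → ℂ) × (ℕ → ℝ) | Success l w Γ M p.1 p.2} := by
  have hx (k : ℕ) : Measurable fun p : (ℕ → ℂ) × (ℕ → ℝ) => p.1 k := by fun_prop
  have hrx (k : ℕ) : Measurable fun p : (ℕ → ℂ) × (ℕ → ℝ) => rxPower l p.1 p.2 k := by
    unfold rxPower
    fun_prop
  have hS (k : ℕ) (i : Fin M) :
      MeasurableSet {p : (ℕ → ℂ) × (ℕ → ℝ) | p.1 k ∈ sector M i} :=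
    hx k (measurableSet_sector M i)
  unfold Success Detected IsBest
  simp only [Set.ofPred_exists, Set.ofPred_and, Set.ofPred_forall]
  refine .iUnion fun i => .iUnion fun k => .inter (.inter (hS k i) (.iInter fun j => ?_)) ?_
  · simp only [imp_iff_not_or, Set.ofPred_or]
    exact (hS j i).compl.union (measurableSet_le (by fun_prop) (by fun_prop))
  · refine measurableSet_lt measurable_const ?_
    unfold sinr
    refine (hrx k).div (.add_const (.tsum fun j => ?_) _)
    exact Measurable.ite (.inter (.const _) (hS j i)) (hrx j) measurable_const

/-- Given the base stations, the number of cycles is geometrically distributed. -/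
lemma meanCycles_eq {Ω : Type*} [MeasurableSpace Ω] (P : Measure Ω) [IsProbabilityMeasure P]
    (X : ℕ → Ω → ℂ) (F : ℕ → ℕ → Ω → ℝ) (C α Γ : ℝ) (hXm : ∀ k, Measurable (X k))
    (hF : IsRayleighFading F P)
    (hXF : IndepFun (fun ω (k : ℕ) => X k ω) (fun ω (p : ℕ × ℕ) => F p.1 p.2 ω) P) (M : ℕ) :
    meanCycles P X F C α Γ M =
      ∫⁻ ω, (fadingLaw {f | Success (pathLoss C α) 0 Γ M (fun k => X k ω) f})⁻¹ ∂P := by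
  have hFm (p : ℕ × ℕ) : Measurable (F p.1 p.2) := hF.measurable _ _
  have hXm' : Measurable fun ω (k : ℕ) => X k ω := measurable_pi_iff.2 hXm
  have hFm' : Measurable fun ω (p : ℕ × ℕ) => F p.1 p.2 ω := measurable_pi_iff.2 hFm
  have hFlaw : P.map (fun ω (p : ℕ × ℕ) => F p.1 p.2 ω)
      = Measure.infinitePi fun _ => expMeasure 1 := by
    rw [hF.indep.map_fun_eq_infinitePi_map hFm]
    congr 1
    ext1 p
    exact (hF.hasLaw _ _).map_eq
  have hrow : Measurable fun ω (n k : ℕ) => F n k ω :=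
    measurable_pi_iff.2 fun n => measurable_pi_iff.2 fun k => hF.measurable n k
  -- Currying the product law over pairs exhibits the cycles as i.i.d. rows with law `fadingLaw`.
  have hrows : P.map (fun ω (n k : ℕ) => F n k ω) = Measure.infinitePi fun _ => fadingLaw := by
    unfold fadingLaw
    rw [← Measure.infinitePi_map_curry fun _ _ : ℕ => expMeasure 1, ← hFlaw,
      Measure.map_map (by fun_prop) hFm']
    rfl
  have hGm (n : ℕ) : Measurable fun ω (k : ℕ) => F n k ω :=
    measurable_pi_iff.2 fun k => hF.measurable n k
  have hlaw (n : ℕ) : P.map (fun ω (k : ℕ) => F n k ω) = fadingLaw := by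
    rw [← Measure.infinitePi_map_eval (fun _ : ℕ => fadingLaw) n, ← hrows,
      Measure.map_map (by fun_prop) hrow]
    rfl
  have hind : iIndepFun (fun n ω (k : ℕ) => F n k ω) P := by
    rw [iIndepFun_iff_map_fun_eq_infinitePi_map hGm, hrows]
    simp_rw [hlaw]
  have hsucc := measurableSet_success (measurable_pathLoss C α) 0 Γ M
  let L : (ℕ → ℂ) × (ℕ × ℕ → ℝ) → ℝ≥0∞ := fun p =>
    (numCycles (pathLoss C α) 0 Γ M p.1 (fun n k => p.2 (n, k)) : ℝ≥0∞)
  have hL : Measurable L := by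
    simp only [L, natCast_tsum]
    refine .tsum fun n => Measurable.ite ?_ measurable_const measurable_const
    simp only [numCycles, natCast_lt_iInf_iff, Set.ofPred_forall]
    refine Finset.measurableSet_biInter _ fun i _ => MeasurableSet.compl ?_
    have : Measurable fun p : (ℕ → ℂ) × (ℕ × ℕ → ℝ) => (p.1, fun k => p.2 (i, k)) := by fun_prop
    exact this hsucc
  have h1 : meanCycles P X F C α Γ M
      = ∫⁻ p, L p ∂(P.map fun ω => (fun k => X k ω, fun p : ℕ × ℕ => F p.1 p.2 ω)) := by
    rw [lintegral_map hL (hXm'.prodMk hFm')]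
    rfl
  -- Independence and Tonelli freeze the stations, and the inner integral is a geometric waiting
  -- time.
  rw [h1, (indepFun_iff_map_prod_eq_prod_map_map hXm'.aemeasurable hFm'.aemeasurable).1 hXF,
    lintegral_prod _ hL.aemeasurable, lintegral_map hL.lintegral_prod_right' hXm']
  refine lintegral_congr fun ω => ?_
  rw [lintegral_map (by fun_prop) hFm']
  exact lintegral_waitingTime hGm hind hlaw (measurable_prodMk_left hsucc)

end

/-! ### The detection probability of a sector -/

section

lemma expMeasure_one_eq : expMeasure 1 = volume.withDensity (exponentialPDF 1) := rfl

/-- The value `y = ∞` is allowed because the total interference may diverge; both sides are then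
zero. -/
lemma expMeasure_one_lt (y : ℝ≥0∞) :
    expMeasure 1 {t | y < ENNReal.ofReal t} = (expE y)⁻¹ := by
  by_cases hy : y = ∞
  · subst hy
    simp [expE]
  lift y to ℝ≥0 using hy
  have h1 : {t : ℝ | (y : ℝ≥0∞) < ENNReal.ofReal t} = (Set.Iic (y : ℝ))ᶜ := by
    ext t
    rw [Set.mem_ofPred_eq, ← ENNReal.ofReal_coe_nnreal, ENNReal.ofReal_lt_ofReal_iff']
    simp only [Set.mem_compl_iff, Set.mem_Iic, not_le, and_iff_left_iff_imp]
    exact fun h => y.2.trans_lt h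
  rw [h1, prob_compl_eq_one_sub measurableSet_Iic, expMeasure_one_eq,
    withDensity_apply _ measurableSet_Iic, lintegral_exponentialPDF_eq_antiDeriv one_pos,
    if_pos y.coe_nonneg, ← ENNReal.ofReal_one, ← ENNReal.ofReal_sub _ (by simp), 
    ← ENNReal.ofReal_coe_nnreal, expE_ofReal y.coe_nonneg, ← ENNReal.ofReal_inv_of_pos (Real.exp_pos _),
    ← Real.exp_neg]
  simp

/-- Multiplied by `1 + c`, the integrand becomes the density of the exponential law of rate `1 + c`,
which has mass one. -/
lemma lintegral_inv_expE_mul (c : ℝ≥0∞) (hc : c ≠ ∞) :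
    ∫⁻ t, (expE (c * ENNReal.ofReal t))⁻¹ ∂(expMeasure 1) = (1 + c)⁻¹ := by
  lift c to ℝ≥0 using hc
  have hc1 : (0 : ℝ) < 1 + c := by positivity
  have h0 : (1 + c : ℝ≥0∞) = ENNReal.ofReal (1 + c) := by
    rw [ENNReal.ofReal_add zero_le_one c.coe_nonneg]; simp
  have hmeas : Measurable fun t => (expE ((c : ℝ≥0∞) * ENNReal.ofReal t))⁻¹ :=
    (measurable_expE.comp (by fun_prop)).inv
  have hpdf : Measurable (exponentialPDF 1) := (measurable_exponentialPDFReal 1).ennreal_ofReal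
  rw [expMeasure_one_eq, lintegral_withDensity_eq_lintegral_mul _ hpdf hmeas]
  refine ENNReal.eq_inv_of_mul_eq_one_left ?_
  rw [mul_comm, ← lintegral_const_mul _ (hpdf.mul hmeas)]
  refine Eq.trans ?_ (lintegral_exponentialPDF_eq_one hc1)
  refine lintegral_congr fun t => ?_
  rcases lt_or_ge t 0 with ht | ht
  · simp [exponentialPDF_of_neg ht]
  · rw [Pi.mul_apply, exponentialPDF_of_nonneg ht, exponentialPDF_of_nonneg ht, h0,
      ← ENNReal.ofReal_coe_nnreal, ← ENNReal.ofReal_mul c.coe_nonneg, expE_ofReal (by positivity),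
      ← ENNReal.ofReal_inv_of_pos (Real.exp_pos _), ← Real.exp_neg,
      ← ENNReal.ofReal_mul (by positivity), ← ENNReal.ofReal_mul (by positivity), one_mul,
      ← Real.exp_add]
    congr 3
    ring

lemma iIndepFun_eval_fadingLaw : iIndepFun (fun k (f : ℕ → ℝ) => f k) fadingLaw :=
  iIndepFun_infinitePi (X := fun _ x => x) fun _ => measurable_id

lemma map_eval_fadingLaw (k : ℕ) : fadingLaw.map (fun f => f k) = expMeasure 1 :=
  Measure.infinitePi_map_eval _ k

lemma lintegral_inv_expE_sum (s : Finset ℕ) (c : ℕ → ℝ≥0∞) (hc : ∀ j, c j ≠ ∞) :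
    ∫⁻ f, (expE (∑ j ∈ s, c j * ENNReal.ofReal (f j)))⁻¹ ∂fadingLaw
      = (expE (∑ j ∈ s, logOneAdd (c j)))⁻¹ := by
  have hm (j : ℕ) : Measurable fun t : ℝ => (expE (c j * ENNReal.ofReal t))⁻¹ :=
    (measurable_expE.comp (by fun_prop)).inv
  have h (u : ℕ → ℝ≥0∞) (hu : ∀ j, 1 ≤ u j) : (∏ j ∈ s, u j)⁻¹ = ∏ j ∈ s, (u j)⁻¹ :=
    ENNReal.prod_inv_distrib fun i _ j _ _ => Or.inl (zero_lt_one.trans_le (hu i)).ne'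
  simp_rw [expE_sum]
  rw [h _ fun j => one_le_expE _]
  simp_rw [h _ fun j => one_le_expE _]
  refine (lintegral_prod_eq_prod_lintegral_of_indepFun s _
    (iIndepFun_eval_fadingLaw.comp (fun j t => (expE (c j * ENNReal.ofReal t))⁻¹) hm)
    fun j => (hm j).comp (measurable_pi_apply j)).trans ?_
  refine Finset.prod_congr rfl fun j _ => ?_
  rw [expE_logOneAdd, ← lintegral_inv_expE_mul _ (hc j), ← map_eval_fadingLaw j,
    lintegral_map (hm j) (measurable_pi_apply j)]
  rfl

/-- Limit of the finite case by dominated convergence: `expE ≥ 1` bounds the integrands by one. -/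
lemma lintegral_inv_expE_tsum (c : ℕ → ℝ≥0∞) (hc : ∀ j, c j ≠ ∞) :
    ∫⁻ f, (expE (∑' j, c j * ENNReal.ofReal (f j)))⁻¹ ∂fadingLaw
      = (expE (∑' j, logOneAdd (c j)))⁻¹ := by
  have hlim (u : ℕ → ℝ≥0∞) : Tendsto (fun n => (expE (∑ j ∈ Finset.range n, u j))⁻¹) atTop
      (𝓝 (expE (∑' j, u j))⁻¹) :=
    ((continuous_inv.comp continuous_expE).tendsto _).comp (ENNReal.tendsto_nat_tsum u)
  refine tendsto_nhds_unique ?_ (hlim fun j => logOneAdd (c j))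
  simp_rw [← lintegral_inv_expE_sum _ c hc]
  refine tendsto_lintegral_of_dominated_convergence (fun _ => 1) (fun n => ?_) (fun n => ?_)
    (by simp) (ae_of_all _ fun f => hlim _)
  · exact (measurable_expE.comp (by fun_prop)).inv
  · exact ae_of_all _ fun f => ENNReal.inv_le_one.mpr (one_le_expE _)

/-- The zero weight at `k` makes the sum measurable for the σ-algebra of the other coordinates
alone, which gives its independence from coordinate `k`. -/
lemma measurable_weightedSum {Ω : Type*} {m0 : MeasurableSpace Ω} (c : ℕ → ℝ≥0∞) {k : ℕ}
    (hk : c k = 0) (Z : ℕ → Ω → ℝ) (hZ : ∀ j, j ≠ k → Measurable (Z j)) :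
    Measurable fun ω => ∑' j, c j * ENNReal.ofReal (Z j ω) := by
  refine .tsum fun j => ?_
  by_cases hj : j = k
  · simp [hj, hk]
  · have := hZ j hj
    fun_prop

/-- The probability that an exponential signal exceeds a weighted sum of independent exponential
interferers. -/
lemma fadingLaw_tsum_lt (c : ℕ → ℝ≥0∞) (hc : ∀ j, c j ≠ ∞) (k : ℕ) (hk : c k = 0) :
    fadingLaw {f | ∑' j, c j * ENNReal.ofReal (f j) < ENNReal.ofReal (f k)}
      = (expE (∑' j, logOneAdd (c j)))⁻¹ := by
  have hY : Measurable fun f : ℕ → ℝ => ∑' j, c j * ENNReal.ofReal (f j) := by fun_prop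
  let m : ℕ → MeasurableSpace (ℕ → ℝ) := fun j => MeasurableSpace.comap (fun f => f j) inferInstance
  have hind : IndepFun (fun f : ℕ → ℝ => f k) (fun f => ∑' j, c j * ENNReal.ofReal (f j))
      fadingLaw := by
    have hd : Disjoint ({k} : Set ℕ) {k}ᶜ := disjoint_compl_right
    have := indep_iSup_of_disjoint (m := m) (fun j => (measurable_pi_apply j).comap_le)
      iIndepFun_eval_fadingLaw hd
    refine indep_of_indep_of_le_left (indep_of_indep_of_le_right this ?_) ?_
    · rw [← measurable_iff_comap_le]
      refine measurable_weightedSum (m0 := ⨆ i ∈ ({k} : Set ℕ)ᶜ, m i) c hk (fun j f => f j)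
        fun j hj => ?_
      rw [measurable_iff_comap_le]
      exact le_iSup₂_of_le j hj le_rfl
    · simp [m]
  have hS : MeasurableSet {p : ℝ × ℝ≥0∞ | p.2 < ENNReal.ofReal p.1} :=
    measurableSet_lt (by fun_prop) (by fun_prop)
  have hpair : Measurable fun f : ℕ → ℝ => (f k, ∑' j, c j * ENNReal.ofReal (f j)) :=
    (measurable_pi_apply k).prodMk hY
  have : {f : ℕ → ℝ | ∑' j, c j * ENNReal.ofReal (f j) < ENNReal.ofReal (f k)}
      = (fun f => (f k, ∑' j, c j * ENNReal.ofReal (f j))) ⁻¹'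
        {p : ℝ × ℝ≥0∞ | p.2 < ENNReal.ofReal p.1} := rfl
  -- Integrating out the signal first leaves `exp(-interference)`, whose mean is the Laplace
  -- transform already computed.
  rw [this, ← Measure.map_apply hpair hS, (indepFun_iff_map_prod_eq_prod_map_map
    (measurable_pi_apply k).aemeasurable hY.aemeasurable).1 hind, map_eval_fadingLaw,
    Measure.prod_apply_symm hS, ← lintegral_inv_expE_tsum c hc,
    lintegral_map (measurable_measure_prodMk_right hS) hY]
  exact lintegral_congr fun f => expMeasure_one_lt _

open scoped Classical in
/-- The weight of the interferer `j` relative to the serving station `k`. -/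
def interference (α Γ : ℝ) (x : ℕ → ℂ) (S : Set ℂ) (k j : ℕ) : ℝ≥0∞ :=
  if j ≠ k ∧ x j ∈ S then ENNReal.ofReal (Γ * (‖x k‖ / ‖x j‖) ^ α) else 0

lemma pathLoss_le_iff {C α r s : ℝ} (hC : 0 < C) (hα : 0 < α) (hr : 0 ≤ r) (hs : 0 ≤ s) :
    pathLoss C α r ≤ pathLoss C α s ↔ r ≤ s := by
  rw [pathLoss, pathLoss, mul_le_mul_iff_right₀ hC, Real.rpow_le_rpow_iff hr hs hα]

/-- The detection probability of the sector `S` through its closest station `k`. -/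
lemma fadingLaw_sinr {C α Γ : ℝ} (hC : 0 < C) (hα : 0 < α) (hΓ : 0 < Γ) (x : ℕ → ℂ) (S : Set ℂ)
    (k : ℕ) (hk : IsBest (pathLoss C α) x S k) (hk0 : x k ≠ 0) :
    fadingLaw {f | ENNReal.ofReal Γ < sinr (pathLoss C α) 0 x f S k}
      = (expE (∑' j, logOneAdd (interference α Γ x S k j)))⁻¹ := by
  have hpos {r : ℝ} (hr : 0 < r) : 0 < pathLoss C α r := mul_pos hC (Real.rpow_pos_of_pos hr _)
  have hkn : 0 < ‖x k‖ := norm_pos_iff.mpr hk0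
  rw [← fadingLaw_tsum_lt _ (fun j => ?_) k (by simp [interference])]
  · congr 1
    ext f
    simp only [Set.mem_ofPred_eq, sinr, add_zero]
    have hl := hpos hkn
    -- Clearing denominators turns the SINR condition into `∑ c_j F_j < F_k`; the constant `C`
    -- cancels in each `c_j`.
    rw [ENNReal.lt_div_iff_mul_lt (Or.inr (by simp)) (Or.inr (by simpa using hΓ)), rxPower,
      ENNReal.lt_div_iff_mul_lt (Or.inl (by simpa using hl)) (Or.inl (by simp)),
      ← ENNReal.tsum_mul_left, ← ENNReal.tsum_mul_right]
    congr! 3 with j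
    unfold interference rxPower
    split_ifs with hj
    · have hjn : 0 < ‖x j‖ := hkn.trans_le
        ((pathLoss_le_iff hC hα (norm_nonneg _) (norm_nonneg _)).1 (hk.2 j hj.2))
      have hlj := hpos hjn
      have hrw : ENNReal.ofReal Γ * (ENNReal.ofReal (f j) / ENNReal.ofReal (pathLoss C α ‖x j‖)) *
          ENNReal.ofReal (pathLoss C α ‖x k‖) = ENNReal.ofReal Γ *
          (ENNReal.ofReal (pathLoss C α ‖x k‖) / ENNReal.ofReal (pathLoss C α ‖x j‖)) *
            ENNReal.ofReal (f j) := by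
        simp only [div_eq_mul_inv]
        ring
      rw [hrw, ← ENNReal.ofReal_div_of_pos hlj, ← ENNReal.ofReal_mul hΓ.le]
      congr 3
      rw [Real.div_rpow hkn.le hjn.le, pathLoss, pathLoss]
      have := Real.rpow_pos_of_pos hjn α
      field_simp
    · simp
  · unfold interference
    split_ifs <;> simp

end

/-! ### The generating functional of a Poisson point process -/

section

lemma lintegral_pointMeasure {Ω E : Type*} [MeasurableSpace E] (X : ℕ → Ω → E) (ω : Ω)
    {g : E → ℝ≥0∞} (hg : Measurable g) : ∫⁻ z, g z ∂(pointMeasure X ω) = ∑' k, g (X k ω) := by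
  simp [pointMeasure, lintegral_sum_measure, lintegral_dirac' _ hg]

lemma pointMeasure_apply {Ω E : Type*} [MeasurableSpace E] (X : ℕ → Ω → E) (ω : Ω)
    {A : Set E} (hA : MeasurableSet A) :
    pointMeasure X ω A = ∑' k, A.indicator 1 (X k ω) := by
  rw [← lintegral_indicator_one hA, lintegral_pointMeasure _ _ (measurable_one.indicator hA)]

lemma measurable_pointMeasure {Ω E : Type*} [MeasurableSpace Ω] [MeasurableSpace E]
    {X : ℕ → Ω → E} (hX : ∀ k, Measurable (X k)) {A : Set E} (hA : MeasurableSet A) :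
    Measurable fun ω => pointMeasure X ω A := by
  simp_rw [pointMeasure_apply X _ hA]
  exact .tsum fun k => (measurable_one.indicator hA).comp (hX k)

lemma measurable_lintegral_pointMeasure {Ω E : Type*} [MeasurableSpace Ω] [MeasurableSpace E]
    {X : ℕ → Ω → E} (hX : ∀ k, Measurable (X k)) {g : E → ℝ≥0∞} (hg : Measurable g) :
    Measurable fun ω => ∫⁻ z, g z ∂(pointMeasure X ω) := by
  simp_rw [lintegral_pointMeasure X _ hg]
  exact .tsum fun k => hg.comp (hX k)

lemma lintegral_poissonMeasure (r : ℝ≥0) (φ : ℕ → ℝ≥0∞) :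
    ∫⁻ n, φ n ∂(poissonMeasure r)
      = ∑' n : ℕ, ENNReal.ofReal (Real.exp (-r) * r ^ n / n.factorial) * φ n := by
  simp [poissonMeasure, lintegral_sum_measure, lintegral_smul_measure, lintegral_dirac]

/-- The probability generating function of the Poisson distribution. -/
lemma lintegral_poissonMeasure_pow (r c : ℝ≥0) :
    ∫⁻ n, expE (n * logOneAdd c) ∂(poissonMeasure r) = expE (r * c) := by
  rw [lintegral_poissonMeasure]
  have h (n : ℕ) : ENNReal.ofReal (Real.exp (-r) * r ^ n / n.factorial) *
      expE (n * logOneAdd c) =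
        ENNReal.ofReal (Real.exp (-r) * ((r * (1 + c)) ^ n / n.factorial)) := by
    have : (1 + c : ℝ≥0∞) = ENNReal.ofReal (1 + c) := by
      rw [ENNReal.ofReal_add zero_le_one c.coe_nonneg]; simp
    rw [expE_natCast_mul, expE_logOneAdd, this, ← ENNReal.ofReal_pow (by positivity),
      ← ENNReal.ofReal_mul (by positivity), mul_pow]
    congr 1
    ring
  have hs : HasSum (fun n : ℕ => Real.exp (-r) * ((r * (1 + c) : ℝ) ^ n / n.factorial))
      (Real.exp (-r) * Real.exp (r * (1 + c))) := by
    rw [Real.exp_eq_exp_ℝ]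
    exact (NormedSpace.expSeries_div_hasSum_exp (r * (1 + c) : ℝ)).mul_left _
  simp_rw [h]
  rw [← ENNReal.ofReal_tsum_of_nonneg (fun n => by positivity) hs.summable, hs.tsum_eq,
    ← Real.exp_add, ← ENNReal.ofReal_coe_nnreal, ← ENNReal.ofReal_coe_nnreal,
    ← ENNReal.ofReal_mul r.coe_nonneg, expE_ofReal (by positivity)]
  congr 2
  ring

variable {Ω E : Type*} [MeasurableSpace Ω] [MeasurableSpace E] {P : Measure Ω}
  {X : ℕ → Ω → E} {μ : Measure E}

lemma IsPoissonPointProcess.lintegral_count (hX : IsPoissonPointProcess X μ P) {A : Set E}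
    (hA : MeasurableSet A) (hμA : μ A ≠ ∞) {φ : ℝ≥0∞ → ℝ≥0∞} (hφ : Measurable φ) :
    ∫⁻ ω, φ (pointMeasure X ω A) ∂P = ∫⁻ n : ℕ, φ n ∂(poissonMeasure (μ A).toNNReal) := by
  have h := (hX.hasLaw A hA hμA.lt_top).map_eq
  rw [← lintegral_map hφ (measurable_pointMeasure hX.measurable hA), h,
    lintegral_map hφ (by fun_prop)]

lemma IsPoissonPointProcess.lintegral_expE_count (hX : IsPoissonPointProcess X μ P) {A : Set E}
    (hA : MeasurableSet A) (hμA : μ A ≠ ∞) (c : ℝ≥0) :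
    ∫⁻ ω, expE (logOneAdd c * pointMeasure X ω A) ∂P = expE (c * μ A) := by
  rw [hX.lintegral_count hA hμA (φ := fun t => expE (logOneAdd c * t))
    (measurable_expE.comp (by fun_prop))]
  simp_rw [mul_comm (logOneAdd c)]
  rw [lintegral_poissonMeasure_pow, ENNReal.coe_toNNReal hμA, mul_comm]

lemma IsPoissonPointProcess.iIndepFun_count (hX : IsPoissonPointProcess X μ P) {ι : Type*}
    [Fintype ι] (A : ι → Set E) (hA : ∀ i, MeasurableSet (A i))
    (hd : Pairwise (Function.onFun Disjoint A)) :
    iIndepFun (fun i ω => pointMeasure X ω (A i)) P := by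
  let e := Fintype.equivFin ι
  have := hX.indep _ (fun i => A (e.symm i)) (fun i => hA _)
    fun i j hij => hd (e.symm.injective.ne hij)
  simpa using this.precomp e.injective

open scoped Classical in
/-- The generating functional of a simple function, jointly with counts in disjoint sets. -/
lemma IsPoissonPointProcess.lintegral_prod_simpleFunc (hX : IsPoissonPointProcess X μ P)
    {ι : Type*} [Fintype ι] (A : ι → Set E) (hA : ∀ i, MeasurableSet (A i))
    (hd : Pairwise (Function.onFun Disjoint A)) {φ : ι → ℝ≥0∞ → ℝ≥0∞}
    (hφ : ∀ i, Measurable (φ i)) (g : SimpleFunc E ℝ≥0∞) (hg : ∀ z, g z ≠ ∞)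
    (hgfin : ∀ c ≠ 0, μ (g ⁻¹' {c}) ≠ ∞) (hgA : ∀ i, ∀ z ∈ A i, g z = 0) :
    ∫⁻ ω, (∏ i, φ i (pointMeasure X ω (A i))) *
        expE (∫⁻ z, logOneAdd (g z) ∂(pointMeasure X ω)) ∂P
      = (∏ i, ∫⁻ ω, φ i (pointMeasure X ω (A i)) ∂P) * expE (∫⁻ z, g z ∂μ) := by
  -- Level sets of nonzero values avoid every `A i`, where `g` vanishes, so all these counts are
  -- jointly independent. The zero level may have infinite intensity, but contributes nothing
  -- because `logOneAdd 0 = 0`.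
  let R := g.range.filter (· ≠ 0)
  let B : ι ⊕ R → Set E := Sum.elim A fun c => g ⁻¹' {c.1}
  have hR (c : R) : c.1 ≠ 0 ∧ c.1 ≠ ∞ := by
    have := c.2
    simp only [R, Finset.mem_filter, SimpleFunc.mem_range, Set.mem_range] at this
    obtain ⟨⟨z, hz⟩, h0⟩ := this
    exact ⟨h0, hz ▸ hg z⟩
  have hB : ∀ i, MeasurableSet (B i) := by
    rintro (i | c)
    · exact hA i
    · exact g.measurableSet_fiber _
  have hBd : Pairwise (Function.onFun Disjoint B) := by
    rintro (i | c) (j | d) hij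
    · exact hd fun h => hij (by rw [h])
    · refine Set.disjoint_left.mpr fun z hz hz' => (hR d).1 ?_
      rw [← show g z = d.1 from hz', hgA i z hz]
    · refine Set.disjoint_left.mpr fun z hz hz' => (hR c).1 ?_
      rw [← show g z = c.1 from hz, hgA j z hz']
    · refine Set.disjoint_left.mpr fun z hz hz' => hij ?_
      rw [Subtype.ext (show c.1 = d.1 from (show g z = c.1 from hz).symm.trans hz')]
  let ψ : ι ⊕ R → ℝ≥0∞ → ℝ≥0∞ := Sum.elim φ fun c t => expE (logOneAdd c.1 * t)
  have hψ : ∀ i, Measurable (ψ i) := by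
    rintro (i | c)
    · exact hφ i
    · exact measurable_expE.comp (by fun_prop)
  have hsum (ν : Measure E) (θ : ℝ≥0∞ → ℝ≥0∞) (h0 : θ 0 = 0) :
      ∫⁻ z, θ (g z) ∂ν = ∑ c : R, θ c * ν (g ⁻¹' {c.1}) := by
    rw [show ∫⁻ z, θ (g z) ∂ν = ∫⁻ z, g.map θ z ∂ν from rfl, SimpleFunc.lintegral_eq_lintegral]
    rw [SimpleFunc.map_lintegral, Finset.sum_coe_sort R fun c => θ c * ν (g ⁻¹' {c}),
      Finset.sum_filter]
    refine Finset.sum_congr rfl fun c _ => ?_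
    split_ifs with hc
    · rfl
    · push Not at hc
      simp [hc, h0]
  have hprod := lintegral_prod_eq_prod_lintegral_of_indepFun Finset.univ
    (fun i => ψ i ∘ fun ω => pointMeasure X ω (B i)) ((hX.iIndepFun_count B hB hBd).comp ψ hψ)
    fun i => (hψ i).comp (measurable_pointMeasure hX.measurable (hB i))
  simp only [Fintype.prod_sum_type, Function.comp_apply, ψ, B, Sum.elim_inl, Sum.elim_inr]
    at hprod
  simp_rw [hsum _ logOneAdd logOneAdd_zero, expE_sum]
  rw [hprod]
  have := hsum μ id rfl
  simp only [id] at this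
  rw [this, expE_sum]
  congr 1
  refine Finset.prod_congr rfl fun c _ => ?_
  have := hX.lintegral_expE_count (g.measurableSet_fiber c.1) (hgfin c.1 (hR c).1) c.1.toNNReal
  rwa [ENNReal.coe_toNNReal (hR c).2] at this

/-- The generating functional of a Poisson point process, jointly with counts in disjoint sets. -/
lemma IsPoissonPointProcess.lintegral_prod_expE [SigmaFinite μ]
    (hX : IsPoissonPointProcess X μ P)
    {ι : Type*} [Fintype ι] (A : ι → Set E) (hA : ∀ i, MeasurableSet (A i))
    (hd : Pairwise (Function.onFun Disjoint A)) {φ : ι → ℝ≥0∞ → ℝ≥0∞}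
    (hφ : ∀ i, Measurable (φ i)) {g : E → ℝ≥0∞} (hg : Measurable g)
    (hgA : ∀ i, ∀ z ∈ A i, g z = 0) :
    ∫⁻ ω, (∏ i, φ i (pointMeasure X ω (A i))) *
        expE (∫⁻ z, logOneAdd (g z) ∂(pointMeasure X ω)) ∂P
      = (∏ i, ∫⁻ ω, φ i (pointMeasure X ω (A i)) ∂P) * expE (∫⁻ z, g z ∂μ) := by
  -- `eapprox` keeps the values finite, and restriction to spanning sets gives the nonzero levels
  -- finite intensity.
  let s : ℕ → SimpleFunc E ℝ≥0∞ := fun n =>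
    (SimpleFunc.eapprox g n).restrict (spanningSets μ n)
  have hs_apply (n : ℕ) (z : E) :
      s n z = (spanningSets μ n).indicator (SimpleFunc.eapprox g n) z :=
    SimpleFunc.restrict_apply _ (measurableSet_spanningSets μ n) z
  have hs_le (n : ℕ) (z : E) : s n z ≤ SimpleFunc.eapprox g n z := by
    rw [hs_apply]
    exact Set.indicator_le_self _ _ _
  have hs_mono : Monotone fun n z => s n z := by
    intro m n hmn z
    simp only [hs_apply]
    exact (Set.indicator_le_indicator (SimpleFunc.monotone_eapprox g hmn z)).trans
      (Set.indicator_le_indicator_of_subset (monotone_spanningSets μ hmn) (fun _ => zero_le) z)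
  have hs_lim (z : E) : Tendsto (fun n => s n z) atTop (𝓝 (g z)) := by
    refine (SimpleFunc.tendsto_eapprox hg z).congr' ?_
    filter_upwards [eventually_ge_atTop (spanningSetsIndex μ z)] with n hn
    rw [hs_apply, Set.indicator_of_mem (mem_spanningSets_of_index_le μ z hn)]
  have hs_fin (n : ℕ) (z : E) : s n z ≠ ∞ :=
    ((hs_le n z).trans_lt (SimpleFunc.eapprox_lt_top g n z)).ne
  have hs_supp (n : ℕ) (c : ℝ≥0∞) (hc : c ≠ 0) : μ (s n ⁻¹' {c}) ≠ ∞ := by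
    refine ((measure_mono ?_).trans_lt (measure_spanningSets_lt_top μ n)).ne
    intro z hz
    by_contra hz'
    refine hc ?_
    rw [← show s n z = c from hz, hs_apply, Set.indicator_of_notMem hz']
  have hs_A (n : ℕ) (i : ι) (z : E) (hz : z ∈ A i) : s n z = 0 := by
    have h1 : s n z ≤ g z := (hs_le n z).trans
      ((le_iSup (fun n => SimpleFunc.eapprox g n z) n).trans_eq
        (SimpleFunc.iSup_eapprox_apply hg z))
    rw [hgA i z hz] at h1
    exact le_antisymm h1 zero_le
  have hstep (n : ℕ) := hX.lintegral_prod_simpleFunc A hA hd hφ (s n) (hs_fin n) (hs_supp n)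
    (hs_A n)
  have hAm (i : ι) : Measurable fun ω => φ i (pointMeasure X ω (A i)) :=
    (hφ i).comp (measurable_pointMeasure hX.measurable (hA i))
  have hlog (ν : Measure E) : Tendsto (fun n => ∫⁻ z, logOneAdd (s n z) ∂ν) atTop
      (𝓝 (∫⁻ z, logOneAdd (g z) ∂ν)) :=
    lintegral_tendsto_of_tendsto_of_monotone
      (fun n => (measurable_logOneAdd.comp (s n).measurable).aemeasurable)
      (ae_of_all _ fun z m n hmn => logOneAdd_mono (hs_mono hmn z))
      (ae_of_all _ fun z => (continuous_logOneAdd.tendsto _).comp (hs_lim z))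
  have hlim1 : Tendsto (fun n => ∫⁻ ω, (∏ i, φ i (pointMeasure X ω (A i))) *
        expE (∫⁻ z, logOneAdd (s n z) ∂(pointMeasure X ω)) ∂P) atTop
      (𝓝 (∫⁻ ω, (∏ i, φ i (pointMeasure X ω (A i))) *
        expE (∫⁻ z, logOneAdd (g z) ∂(pointMeasure X ω)) ∂P)) := by
    refine lintegral_tendsto_of_tendsto_of_monotone (fun n => ?_) (ae_of_all _ fun ω => ?_)
      (ae_of_all _ fun ω => ?_)
    · refine (Measurable.mul (Finset.measurable_fun_prod _ fun i _ => hAm i)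
        (measurable_expE.comp ?_)).aemeasurable
      exact measurable_lintegral_pointMeasure hX.measurable
        (measurable_logOneAdd.comp (s n).measurable)
    · intro m n hmn
      dsimp only
      gcongr
      exact expE_mono (lintegral_mono fun z => logOneAdd_mono (hs_mono hmn z))
    -- The prefactor may be infinite; the product still converges because the limit of the other
    -- factor is nonzero.
    · exact ENNReal.Tendsto.const_mul ((continuous_expE.tendsto _).comp (hlog _))
        (Or.inl (expE_ne_zero _))
  have hlim2 : Tendsto (fun n => (∏ i, ∫⁻ ω, φ i (pointMeasure X ω (A i)) ∂P) *
      expE (∫⁻ z, s n z ∂μ)) atTop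
      (𝓝 ((∏ i, ∫⁻ ω, φ i (pointMeasure X ω (A i)) ∂P) * expE (∫⁻ z, g z ∂μ))) := by
    refine ENNReal.Tendsto.const_mul ((continuous_expE.tendsto _).comp ?_)
      (Or.inl (expE_ne_zero _))
    exact lintegral_tendsto_of_tendsto_of_monotone (fun n => (s n).measurable.aemeasurable)
      (ae_of_all _ fun z m n hmn => hs_mono hmn z) (ae_of_all _ hs_lim)
  simp_rw [hstep] at hlim1
  exact tendsto_nhds_unique hlim1 hlim2

end

/-! ### Sectors and shells -/

section

lemma angle_nonneg (z : ℂ) : 0 ≤ angle z := by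
  unfold angle
  have := Complex.neg_pi_lt_arg z
  split_ifs with h
  · exact h
  · linarith [Real.pi_pos]

lemma angle_lt (z : ℂ) : angle z < 2 * Real.pi := by
  unfold angle
  have := Complex.arg_le_pi z
  split_ifs with h <;> linarith [Real.pi_pos]

lemma exists_mem_sector {M : ℕ} (hM : 0 < M) (z : ℂ) : ∃ i : Fin M, z ∈ sector M i := by
  have hM' : (0 : ℝ) < M := by exact_mod_cast hM
  have hpi := Real.pi_pos
  have h0 : 0 ≤ angle z * M / (2 * Real.pi) :=
    div_nonneg (mul_nonneg (angle_nonneg z) hM'.le) (by positivity)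
  have h1 : angle z * M / (2 * Real.pi) < M := by
    rw [div_lt_iff₀ (by positivity), mul_comm]
    exact mul_lt_mul_of_pos_left (angle_lt z) hM'
  refine ⟨⟨⌊angle z * M / (2 * Real.pi)⌋₊, (Nat.floor_lt h0).2 h1⟩, ?_, ?_⟩
  · have := Nat.floor_le h0
    rw [le_div_iff₀ (by positivity)] at this
    rw [div_le_iff₀ hM']
    linarith
  · have := Nat.lt_floor_add_one (angle z * M / (2 * Real.pi))
    rw [div_lt_iff₀ (by positivity)] at this
    rw [lt_div_iff₀ hM']
    linarith

lemma sector_one (i : Fin 1) : sector 1 i = Set.univ := by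
  obtain rfl : i = 0 := Subsingleton.elim _ _
  ext z
  simp [sector, angle_nonneg, angle_lt]

/-- Split at `π`: nonnegative arguments are unchanged and negative ones are shifted by `2π`. The two
pieces reassemble `[a, b)` up to the null point `π`, and translation preserves length. -/
lemma volume_angle_Ico {a b : ℝ} (ha : 0 ≤ a) (hb : b ≤ 2 * Real.pi) :
    volume ({θ : ℝ | (if 0 ≤ θ then θ else θ + 2 * Real.pi) ∈ Set.Ico a b} ∩
      Set.Ioo (-Real.pi) Real.pi) = ENNReal.ofReal (b - a) := by
  have hpi := Real.pi_pos
  have hset : {θ : ℝ | (if 0 ≤ θ then θ else θ + 2 * Real.pi) ∈ Set.Ico a b} ∩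
      Set.Ioo (-Real.pi) Real.pi = (Set.Ico a b ∩ Set.Iio Real.pi) ∪
        (fun θ => θ + 2 * Real.pi) ⁻¹' (Set.Ico a b ∩ Set.Ioi Real.pi) := by
    ext θ
    simp only [Set.mem_inter_iff, Set.mem_ofPred_eq, Set.mem_Ico, Set.mem_Ioo, Set.mem_union,
      Set.mem_preimage, Set.mem_Iio, Set.mem_Ioi]
    split_ifs with h
    · constructor
      · exact fun h' => Or.inl ⟨h'.1, h'.2.2⟩
      · rintro (h' | h')
        · exact ⟨h'.1, by linarith, h'.2⟩
        · linarith [h'.1.2]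
    · push Not at h
      constructor
      · exact fun h' => Or.inr ⟨h'.1, by linarith [h'.2.1]⟩
      · rintro (h' | h')
        · linarith [h'.1.1]
        · exact ⟨h'.1, by linarith [h'.2], by linarith⟩
  have hdisj : Disjoint (Set.Ico a b ∩ Set.Iio Real.pi)
      ((fun θ => θ + 2 * Real.pi) ⁻¹' (Set.Ico a b ∩ Set.Ioi Real.pi)) := by
    refine Set.disjoint_left.mpr fun θ h h' => ?_
    have h1 := h.1.1
    have h2 : θ + 2 * Real.pi < b := h'.1.2
    linarith
  rw [hset, measure_union hdisj ((measurableSet_Ico.inter measurableSet_Ioi).preimage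
    (by fun_prop)), measure_preimage_add_right,
    measure_congr ((ae_eq_refl (Set.Ico a b)).inter (Ioi_ae_eq_Ici (a := Real.pi))),
    ← Set.compl_Iio, ← Set.sdiff_eq, measure_inter_add_sdiff _ measurableSet_Iio, Real.volume_Ico]

/-- Integration of a radial function over a sector in polar coordinates. -/
lemma setLIntegral_sector_radial {M : ℕ} (i : Fin M) {f : ℝ → ℝ≥0∞} (hf : Measurable f) :
    ∫⁻ z in sector M i, f ‖z‖
      = ENNReal.ofReal (2 * Real.pi / M) * ∫⁻ r in Set.Ioi 0, ENNReal.ofReal r * f r := by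
  have hM : (0 : ℝ) < M := by exact_mod_cast i.pos
  have hpi := Real.pi_pos
  let T : Set ℝ := {θ | (if 0 ≤ θ then θ else θ + 2 * Real.pi) ∈
    Set.Ico (2 * Real.pi * (i : ℕ) / M) (2 * Real.pi * ((i : ℕ) + 1) / M)}
  have hT : MeasurableSet T :=
    (Measurable.ite measurableSet_Ici measurable_id (by fun_prop) :
      Measurable fun θ : ℝ => if 0 ≤ θ then θ else θ + 2 * Real.pi) measurableSet_Ico
  have hvol : volume (T ∩ Set.Ioo (-Real.pi) Real.pi) = ENNReal.ofReal (2 * Real.pi / M) := by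
    rw [volume_angle_Ico (by positivity)]
    · congr 1
      ring
    · rw [div_le_iff₀ hM]
      have : ((i : ℕ) : ℝ) + 1 ≤ M := by exact_mod_cast i.2
      gcongr
  rw [← lintegral_indicator (measurableSet_sector M i), ← Complex.lintegral_comp_polarCoord_symm]
  -- In polar coordinates the integrand separates into a radial factor and an indicator of angles.
  have hcongr : ∀ p ∈ polarCoord.target, ENNReal.ofReal p.1 •
      (sector M i).indicator (fun z => f ‖z‖) (Complex.polarCoord.symm p)
        = (ENNReal.ofReal p.1 * f p.1) * T.indicator 1 p.2 := by
    rintro ⟨r, θ⟩ ⟨hr, hθ⟩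
    have hr' : 0 < r := hr
    have harg : (Complex.polarCoord.symm (r, θ)).arg = θ := by
      rw [Complex.polarCoord_symm_apply]
      have := Complex.arg_mul_cos_add_sin_mul_I hr' (θ := θ) ⟨hθ.1, hθ.2.le⟩
      simpa using this
    have hnorm : ‖Complex.polarCoord.symm (r, θ)‖ = r := by
      rw [Complex.norm_polarCoord_symm, abs_of_pos hr']
    have hmem : Complex.polarCoord.symm (r, θ) ∈ sector M i ↔ θ ∈ T := by
      simp only [sector, angle, Set.mem_ofPred_eq, harg, T]
    by_cases h : θ ∈ T
    · simp [Set.indicator_of_mem (hmem.2 h), h, -Complex.polarCoord_symm_apply, hnorm]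
    · simp [Set.indicator_of_notMem (fun h' => h (hmem.1 h')), h,
        -Complex.polarCoord_symm_apply]
  rw [setLIntegral_congr_fun polarCoord.open_target.measurableSet hcongr]
  rw [show polarCoord.target = Set.Ioi (0 : ℝ) ×ˢ Set.Ioo (-Real.pi) Real.pi from rfl,
    Measure.volume_eq_prod, ← Measure.prod_restrict,
    lintegral_prod_mul (f := fun r => ENNReal.ofReal r * f r) (g := T.indicator 1)
      (by fun_prop) (measurable_one.indicator hT).aemeasurable,
    lintegral_indicator_one hT, Measure.restrict_apply hT, hvol, mul_comm]

/-- The points at distance in `[a, b)` from the origin. -/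
def shell (a b : ℝ) : Set ℂ := {z | a ≤ ‖z‖ ∧ ‖z‖ < b}

lemma measurableSet_shell (a b : ℝ) : MeasurableSet (shell a b) :=
  (measurableSet_le measurable_const measurable_norm).inter
    (measurableSet_lt measurable_norm measurable_const)

lemma setLIntegral_ofReal_Ico {a b : ℝ} (ha : 0 ≤ a) (hab : a ≤ b) :
    ∫⁻ r in Set.Ico a b, ENNReal.ofReal r = ENNReal.ofReal ((b ^ 2 - a ^ 2) / 2) := by
  rw [setLIntegral_congr Ico_ae_eq_Ioc, ← ofReal_integral_eq_lintegral_ofReal,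
    ← intervalIntegral.integral_of_le hab, integral_id]
  · exact (intervalIntegrable_iff_integrableOn_Ioc_of_le hab).1
      intervalIntegral.intervalIntegrable_id
  · exact (ae_restrict_iff' measurableSet_Ioc).2 (ae_of_all _ fun r hr => ha.trans hr.1.le)

/-- The intensity measure of the base stations. -/
abbrev intensity (lam : ℝ) : Measure ℂ := ENNReal.ofReal lam • (volume : Measure ℂ)

lemma intensity_sector_shell {M : ℕ} (i : Fin M) {lam a b : ℝ} (hlam : 0 < lam) (ha : 0 ≤ a)
    (hab : a ≤ b) : intensity lam (sector M i ∩ shell a b)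
      = ENNReal.ofReal (lam * Real.pi * (b ^ 2 - a ^ 2) / M) := by
  have hf : Measurable ((Set.Ico a b).indicator (1 : ℝ → ℝ≥0∞)) :=
    measurable_one.indicator measurableSet_Ico
  have h := setLIntegral_sector_radial i hf
  have h1 (z : ℂ) : (Set.Ico a b).indicator (1 : ℝ → ℝ≥0∞) ‖z‖ = (shell a b).indicator 1 z := rfl
  simp_rw [h1] at h
  rw [lintegral_indicator_one (measurableSet_shell a b),
    Measure.restrict_apply (measurableSet_shell a b), Set.inter_comm] at h
  have h2 (r : ℝ) : ENNReal.ofReal r * (Set.Ico a b).indicator (1 : ℝ → ℝ≥0∞) r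
      = (Set.Ico a b).indicator (fun r => ENNReal.ofReal r) r := by
    by_cases hr : r ∈ Set.Ico a b <;> simp [hr]
  simp_rw [h2] at h
  rw [setLIntegral_indicator measurableSet_Ico] at h
  have h3 : (Set.Ico a b ∩ Set.Ioi 0 : Set ℝ) =ᵐ[volume] Set.Ico a b := by
    have := (ae_eq_refl (Set.Ico a b)).inter (Ioi_ae_eq_Ici (a := (0 : ℝ)) (μ := volume))
    rwa [Set.inter_eq_left.2 (Set.Ico_subset_Ici_self.trans (Set.Ici_subset_Ici.2 ha))] at this
  rw [setLIntegral_congr h3, setLIntegral_ofReal_Ico ha hab] at h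
  rw [Measure.smul_apply, h, smul_eq_mul, ← ENNReal.ofReal_mul (by positivity),
    ← ENNReal.ofReal_mul hlam.le]
  congr 1
  ring

/-- The integrand is a multiple of `r^(1 - α)`, integrable at infinity because `α > 2`; this is the
source of the factor `1/(α - 2)`. -/
lemma lintegral_tail {Γ α c ρ : ℝ} (hΓ : 0 < Γ) (hα : 2 < α) (hc : 0 ≤ c) (hρ : 0 < ρ) :
    ∫⁻ r in Set.Ioi ρ, ENNReal.ofReal r * ENNReal.ofReal (Γ * (c / r) ^ α)
      = ENNReal.ofReal (Γ * c ^ α * ρ ^ (2 - α) / (α - 2)) := by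
  have hcongr : ∀ r ∈ Set.Ioi ρ, ENNReal.ofReal r * ENNReal.ofReal (Γ * (c / r) ^ α)
      = ENNReal.ofReal (Γ * c ^ α * r ^ (1 - α)) := by
    intro r hr
    have hr0 : 0 < r := hρ.trans hr
    rw [← ENNReal.ofReal_mul hr0.le, Real.div_rpow hc hr0.le, Real.rpow_sub hr0, Real.rpow_one]
    congr 1
    ring
  have hint : IntegrableOn (fun r : ℝ => Γ * c ^ α * r ^ (1 - α)) (Set.Ioi ρ) :=
    (integrableOn_Ioi_rpow_of_lt (by linarith) hρ).const_mul _
  rw [setLIntegral_congr_fun measurableSet_Ioi hcongr, ← ofReal_integral_eq_lintegral_ofReal hint,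
    integral_const_mul, integral_Ioi_rpow_of_lt (by linarith) hρ]
  · congr 1
    have : α - 2 ≠ 0 := by linarith
    have h2 : 1 - α + 1 = 2 - α := by ring
    rw [h2, neg_div, ← div_neg, neg_sub]
    ring
  · refine (ae_restrict_iff' measurableSet_Ioi).2 (ae_of_all _ fun r hr => ?_)
    have hr0 : 0 < r := hρ.trans hr
    change (0 : ℝ) ≤ Γ * c ^ α * r ^ (1 - α)
    positivity

/-- The relative weight of interferers outside the radius `ρ` in the set `S`, for a serving station
at distance `c`. -/
def farField (α Γ : ℝ) (S : Set ℂ) (c ρ : ℝ) : ℂ → ℝ≥0∞ :=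
  (S ∩ {z | ρ ≤ ‖z‖}).indicator fun z => ENNReal.ofReal (Γ * (c / ‖z‖) ^ α)

lemma measurable_farField {α Γ c ρ : ℝ} {S : Set ℂ} (hS : MeasurableSet S) :
    Measurable (farField α Γ S c ρ) :=
  Measurable.indicator (by fun_prop) (hS.inter (measurableSet_le measurable_const measurable_norm))

/-- For `c = ρ` the factor `λπ c^α ρ^(2-α)` is `λπρ²`, the mean count `t` in the disc, so the
integral is `bt` with `b = 2Γ/(M(α-2))`. -/
lemma lintegral_farField {M : ℕ} (i : Fin M) {lam Γ α c ρ : ℝ} (hlam : 0 < lam) (hΓ : 0 < Γ)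
    (hα : 2 < α) (hc : 0 ≤ c) (hρ : 0 < ρ) :
    ∫⁻ z, farField α Γ (sector M i) c ρ z ∂(intensity lam)
      = ENNReal.ofReal (2 * Γ / (α - 2) * (lam * Real.pi * (c ^ α * ρ ^ (2 - α))) / M) := by
  have hf : Measurable ((Set.Ici ρ).indicator fun r : ℝ => ENNReal.ofReal (Γ * (c / r) ^ α)) :=
    Measurable.indicator (by fun_prop) measurableSet_Ici
  have h1 (z : ℂ) : farField α Γ (sector M i) c ρ z = (sector M i).indicator (fun z =>
      (Set.Ici ρ).indicator (fun r : ℝ => ENNReal.ofReal (Γ * (c / r) ^ α)) ‖z‖) z := by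
    rw [farField, ← Set.indicator_indicator]
    rfl
  simp_rw [h1]
  rw [lintegral_indicator (measurableSet_sector M i), Measure.restrict_smul,
    lintegral_smul_measure, setLIntegral_sector_radial i hf]
  have h2 (r : ℝ) : ENNReal.ofReal r *
      (Set.Ici ρ).indicator (fun r : ℝ => ENNReal.ofReal (Γ * (c / r) ^ α)) r
      = (Set.Ici ρ).indicator
        (fun r => ENNReal.ofReal r * ENNReal.ofReal (Γ * (c / r) ^ α)) r := by
    by_cases hr : r ∈ Set.Ici ρ <;> simp [hr]
  simp_rw [h2]
  rw [setLIntegral_indicator measurableSet_Ici, Set.inter_eq_left.2 (Set.Ici_subset_Ioi.2 hρ),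
    setLIntegral_congr Ioi_ae_eq_Ici.symm, lintegral_tail hΓ hα hc hρ, smul_eq_mul,
    ← ENNReal.ofReal_mul (by positivity), ← ENNReal.ofReal_mul hlam.le]
  congr 1
  ring

end

/-! ### Counts in shells -/

section

/-- The indicator that a count is zero. -/
def isVoid (t : ℝ≥0∞) : ℝ≥0∞ := if t = 0 then 1 else 0

/-- The indicator that a count is one. -/
def isSingle (t : ℝ≥0∞) : ℝ≥0∞ := if t = 1 then 1 else 0

/-- The factor `(1 + Γ) ^ (t - 1)` contributed by `t ≥ 1` stations near the serving distance. -/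
def countWeight (Γ : ℝ) (t : ℝ≥0∞) : ℝ≥0∞ :=
  if t = 0 then 0 else expE (logOneAdd (ENNReal.ofReal Γ) * t) * (1 + ENNReal.ofReal Γ)⁻¹

lemma measurable_isVoid : Measurable isVoid :=
  Measurable.ite (measurableSet_singleton 0) measurable_const measurable_const

lemma measurable_isSingle : Measurable isSingle :=
  Measurable.ite (measurableSet_singleton 1) measurable_const measurable_const

lemma measurable_countWeight (Γ : ℝ) : Measurable (countWeight Γ) :=
  Measurable.ite (measurableSet_singleton 0) measurable_const
    ((measurable_expE.comp (by fun_prop)).mul_const _)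

section Counts

variable {Ω E : Type*} [MeasurableSpace Ω] [MeasurableSpace E] {P : Measure Ω}
  {X : ℕ → Ω → E} {μ : Measure E}

lemma ofReal_exp_neg {t : ℝ} (ht : 0 ≤ t) :
    ENNReal.ofReal (Real.exp (-t)) = (expE (ENNReal.ofReal t))⁻¹ := by
  rw [expE_ofReal ht, Real.exp_neg, ENNReal.ofReal_inv_of_pos (Real.exp_pos _)]

lemma IsPoissonPointProcess.lintegral_isVoid (hX : IsPoissonPointProcess X μ P) {A : Set E}
    (hA : MeasurableSet A) (hμA : μ A ≠ ∞) :
    ∫⁻ ω, isVoid (pointMeasure X ω A) ∂P = (expE (μ A))⁻¹ := by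
  rw [hX.lintegral_count hA hμA measurable_isVoid, lintegral_poissonMeasure,
    tsum_eq_single 0 fun n hn => by simp [isVoid, hn]]
  simp only [isVoid, pow_zero, Nat.factorial_zero, Nat.cast_zero, Nat.cast_one, if_true, mul_one,
    div_one]
  rw [ofReal_exp_neg (NNReal.coe_nonneg _), ENNReal.ofReal_coe_nnreal, ENNReal.coe_toNNReal hμA]

lemma IsPoissonPointProcess.lintegral_isSingle (hX : IsPoissonPointProcess X μ P) {A : Set E}
    (hA : MeasurableSet A) (hμA : μ A ≠ ∞) :
    ∫⁻ ω, isSingle (pointMeasure X ω A) ∂P = (expE (μ A))⁻¹ * μ A := by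
  rw [hX.lintegral_count hA hμA measurable_isSingle, lintegral_poissonMeasure,
    tsum_eq_single 1 fun n hn => by simp [isSingle, hn]]
  simp only [isSingle, pow_one, Nat.factorial_one, Nat.cast_one, if_true, mul_one, div_one]
  rw [ENNReal.ofReal_mul (Real.exp_pos _).le, ofReal_exp_neg (NNReal.coe_nonneg _),
    ENNReal.ofReal_coe_nnreal, ENNReal.coe_toNNReal hμA]

/-- The Poisson generating function at `1 + Γ` gives `exp(Γs)`; the void event, of probability
`exp(-s)`, is then removed. The result is `s` to first order, hence no loss as `δ → 0`. -/
lemma IsPoissonPointProcess.lintegral_countWeight (hX : IsPoissonPointProcess X μ P) {A : Set E}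
    (hA : MeasurableSet A) {s Γ : ℝ} (hs : 0 ≤ s) (hΓ : 0 < Γ) (hμA : μ A = ENNReal.ofReal s) :
    ∫⁻ ω, countWeight Γ (pointMeasure X ω A) ∂P
      = ENNReal.ofReal ((Real.exp (Γ * s) - Real.exp (-s)) / (1 + Γ)) := by
  have hμ : μ A ≠ ∞ := by simp [hμA]
  have hcnt := measurable_pointMeasure hX.measurable hA
  have hvoid : Measurable fun ω => isVoid (pointMeasure X ω A) := measurable_isVoid.comp hcnt
  have hweight : Measurable fun ω => countWeight Γ (pointMeasure X ω A) :=
    (measurable_countWeight Γ).comp hcnt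
  have hexp : Measurable fun ω => expE (logOneAdd (ENNReal.ofReal Γ) * pointMeasure X ω A) :=
    measurable_expE.comp (hcnt.const_mul _)
  have hpt (t : ℝ≥0∞) : countWeight Γ t + isVoid t * (1 + ENNReal.ofReal Γ)⁻¹
      = expE (logOneAdd (ENNReal.ofReal Γ) * t) * (1 + ENNReal.ofReal Γ)⁻¹ := by
    unfold countWeight isVoid
    split_ifs with h
    · simp [h]
    · simp
  have h1 : (1 + ENNReal.ofReal Γ)⁻¹ = ENNReal.ofReal (1 + Γ)⁻¹ := by
    rw [ENNReal.ofReal_inv_of_pos (by positivity), ENNReal.ofReal_add zero_le_one hΓ.le,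
      ENNReal.ofReal_one]
  have h2 : ∫⁻ ω, countWeight Γ (pointMeasure X ω A) ∂P + ENNReal.ofReal (Real.exp (-s) / (1 + Γ))
      = ENNReal.ofReal (Real.exp (Γ * s) / (1 + Γ)) := by
    have h3 : ENNReal.ofReal (Real.exp (-s) / (1 + Γ))
        = ∫⁻ ω, isVoid (pointMeasure X ω A) * (1 + ENNReal.ofReal Γ)⁻¹ ∂P := by
      rw [lintegral_mul_const _ hvoid, hX.lintegral_isVoid hA hμ, hμA,
        ← ofReal_exp_neg hs, h1, div_eq_mul_inv, ENNReal.ofReal_mul (Real.exp_pos _).le]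
    rw [h3, ← lintegral_add_left hweight]
    simp_rw [hpt]
    rw [lintegral_mul_const _ hexp,
      show ENNReal.ofReal Γ = (Γ.toNNReal : ℝ≥0∞) from rfl,
      hX.lintegral_expE_count hA hμ, hμA, show (Γ.toNNReal : ℝ≥0∞) = ENNReal.ofReal Γ from rfl,
      ← ENNReal.ofReal_mul hΓ.le, expE_ofReal (by positivity), h1, div_eq_mul_inv,
      ENNReal.ofReal_mul (Real.exp_pos _).le]
  rw [sub_div, ENNReal.ofReal_sub _ (by positivity), ← h2,
    ENNReal.add_sub_cancel_right ENNReal.ofReal_ne_top]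

lemma IsPoissonPointProcess.lintegral_mul_mul_expE [SigmaFinite μ]
    (hX : IsPoissonPointProcess X μ P) {A B : Set E} (hA : MeasurableSet A) (hB : MeasurableSet B)
    (hAB : Disjoint A B) {φ ψ : ℝ≥0∞ → ℝ≥0∞} (hφ : Measurable φ) (hψ : Measurable ψ)
    {g : E → ℝ≥0∞} (hg : Measurable g) (hgA : ∀ z ∈ A, g z = 0) (hgB : ∀ z ∈ B, g z = 0) :
    ∫⁻ ω, φ (pointMeasure X ω A) * ψ (pointMeasure X ω B) *
        expE (∫⁻ z, logOneAdd (g z) ∂(pointMeasure X ω)) ∂P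
      = (∫⁻ ω, φ (pointMeasure X ω A) ∂P) * (∫⁻ ω, ψ (pointMeasure X ω B) ∂P) *
        expE (∫⁻ z, g z ∂μ) := by
  have h := hX.lintegral_prod_expE ![A, B] (by simp [Fin.forall_fin_two, hA, hB]) ?_
    (φ := ![φ, ψ]) (by simp [Fin.forall_fin_two, hφ, hψ]) hg
    (by simpa [Fin.forall_fin_two] using ⟨hgA, hgB⟩)
  · simpa [Fin.prod_univ_two] using h
  · intro i j hij
    fin_cases i <;> fin_cases j <;> simp_all [Function.onFun, hAB.symm]

lemma IsPoissonPointProcess.ae_count_ne_top (hX : IsPoissonPointProcess X μ P) {A : Set E}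
    (hA : MeasurableSet A) (hμA : μ A ≠ ∞) : ∀ᵐ ω ∂P, pointMeasure X ω A ≠ ∞ := by
  have hφ : Measurable fun t : ℝ≥0∞ => if t = ∞ then (1 : ℝ≥0∞) else 0 :=
    Measurable.ite (measurableSet_singleton _) measurable_const measurable_const
  have h := hX.lintegral_count hA hμA hφ
  simp only [ENNReal.natCast_ne_top, if_false, lintegral_zero] at h
  rw [lintegral_eq_zero_iff (by exact hφ.comp (measurable_pointMeasure hX.measurable hA))] at h
  filter_upwards [h] with ω hω hω'
  simp [hω'] at hω

lemma IsPoissonPointProcess.ae_notMem (hX : IsPoissonPointProcess X μ P) {A : Set E}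
    (hA : MeasurableSet A) (hμA : μ A = 0) : ∀ᵐ ω ∂P, ∀ k, X k ω ∉ A := by
  have hφ : Measurable fun t : ℝ≥0∞ => if t = 0 then (0 : ℝ≥0∞) else 1 :=
    Measurable.ite (measurableSet_singleton _) measurable_const measurable_const
  have h := hX.lintegral_count hA (by simp [hμA]) hφ
  have h0 : ∑' n : ℕ, ENNReal.ofReal (Real.exp (-((μ A).toNNReal : ℝ)) * ((μ A).toNNReal : ℝ) ^ n
      / n.factorial) * (if (n : ℝ≥0∞) = 0 then (0 : ℝ≥0∞) else 1) = 0 := by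
    refine ENNReal.tsum_eq_zero.2 fun n => ?_
    by_cases hn : n = 0 <;> simp [hμA, hn]
  rw [lintegral_poissonMeasure, h0,
    lintegral_eq_zero_iff (by exact hφ.comp (measurable_pointMeasure hX.measurable hA))] at h
  filter_upwards [h] with ω hω k hk
  have : pointMeasure X ω A = 0 := by
    by_contra hne
    simp [hne] at hω
  rw [pointMeasure_apply X ω hA, ENNReal.tsum_eq_zero] at this
  simpa [hk] using this k

end Counts

lemma intensity_shell {lam a b : ℝ} (hlam : 0 < lam) (ha : 0 ≤ a) (hab : a ≤ b) :
    intensity lam (shell a b) = ENNReal.ofReal (lam * Real.pi * (b ^ 2 - a ^ 2)) := by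
  simpa [sector_one] using intensity_sector_shell (0 : Fin 1) hlam ha hab

/-- The radius of the disc around the origin with mean number of stations `t`. -/
def radius (lam t : ℝ) : ℝ := √(t / (lam * Real.pi))

lemma radius_mono {lam s t : ℝ} (hlam : 0 < lam) (h : s ≤ t) : radius lam s ≤ radius lam t := by
  have := Real.pi_pos
  unfold radius
  gcongr

lemma radius_zero (lam : ℝ) : radius lam 0 = 0 := by simp [radius]

lemma radius_nonneg (lam t : ℝ) : 0 ≤ radius lam t := Real.sqrt_nonneg _

lemma radius_pos {lam t : ℝ} (hlam : 0 < lam) (ht : 0 < t) : 0 < radius lam t := by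
  have := Real.pi_pos
  unfold radius
  positivity

lemma mul_radius_sq {lam t : ℝ} (hlam : 0 < lam) (ht : 0 ≤ t) :
    lam * Real.pi * radius lam t ^ 2 = t := by
  have := Real.pi_pos
  rw [radius, Real.sq_sqrt (by positivity)]
  field_simp

lemma intensity_shell_radius {lam s t : ℝ} (hlam : 0 < lam) (hs : 0 ≤ s) (hst : s ≤ t) :
    intensity lam (shell (radius lam s) (radius lam t)) = ENNReal.ofReal (t - s) := by
  rw [intensity_shell hlam (radius_nonneg _ _) (radius_mono hlam hst), mul_sub,
    mul_radius_sq hlam hs, mul_radius_sq hlam (hs.trans hst)]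

lemma intensity_disc {lam t : ℝ} (hlam : 0 < lam) (ht : 0 ≤ t) :
    intensity lam (shell 0 (radius lam t)) = ENNReal.ofReal t := by
  simpa [radius_zero] using intensity_shell_radius hlam le_rfl ht

lemma disjoint_shell (a b c : ℝ) : Disjoint (shell a b) (shell b c) :=
  Set.disjoint_left.2 fun _ h h' => absurd h.2 (not_lt.2 h'.1)

lemma pointMeasure_eq_zero_iff {Ω : Type*} {X : ℕ → Ω → ℂ} {A : Set ℂ} (hA : MeasurableSet A) (ω : Ω) :
    pointMeasure X ω A = 0 ↔ ∀ k, X k ω ∉ A := by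
  rw [pointMeasure_apply X ω hA, ENNReal.tsum_eq_zero]
  simp

variable {Ω : Type*} [MeasurableSpace Ω] {P : Measure Ω} {X : ℕ → Ω → ℂ}

/-- Almost surely, the closest station lies in one of the shells that partition the plane. -/
lemma ae_exists_shell {lam δ : ℝ} (hlam : 0 < lam) (hδ : 0 < δ)
    (hX : IsPoissonPointProcess X (intensity lam) P) [IsProbabilityMeasure P] :
    ∀ᵐ ω ∂P, (∀ k, X k ω ≠ 0) ∧ ∃ m : ℕ,
      pointMeasure X ω (shell 0 (radius lam (m * δ))) = 0 ∧
      pointMeasure X ω (shell (radius lam (m * δ)) (radius lam ((m + 1) * δ))) ≠ 0 ∧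
      pointMeasure X ω (shell (radius lam (m * δ)) (radius lam ((m + 1) * δ))) ≠ ∞ := by
  have hm0 (m : ℕ) : 0 ≤ m * δ := by positivity
  have hm1 (m : ℕ) : m * δ ≤ (m + 1) * δ := by gcongr; linarith
  have hzero : ∀ᵐ ω ∂P, ∀ k, X k ω ∉ ({0} : Set ℂ) :=
    hX.ae_notMem (measurableSet_singleton 0) (by simp)
  have hfin : ∀ᵐ ω ∂P, ∀ m : ℕ,
      pointMeasure X ω (shell (radius lam (m * δ)) (radius lam ((m + 1) * δ))) ≠ ∞ :=
    ae_all_iff.2 fun m => hX.ae_count_ne_top (measurableSet_shell _ _)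
      (by rw [intensity_shell_radius hlam (hm0 m) (hm1 m)]; simp)
  -- All discs are void with probability at most `exp(-mδ)` for every `m`, hence with probability
  -- zero.
  have hne : ∀ᵐ ω ∂P, ∃ m : ℕ, pointMeasure X ω (shell 0 (radius lam (m * δ))) ≠ 0 := by
    have hint (m : ℕ) : ∫⁻ ω, isVoid (pointMeasure X ω (shell 0 (radius lam (m * δ)))) ∂P
        = ENNReal.ofReal (Real.exp (-(m * δ))) := by
      rw [hX.lintegral_isVoid (measurableSet_shell _ _) (by rw [intensity_disc hlam (hm0 m)]; exact ENNReal.ofReal_ne_top),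
        intensity_disc hlam (hm0 m), ofReal_exp_neg (hm0 m)]
    have hmeas (m : ℕ) :
        MeasurableSet {ω | pointMeasure X ω (shell 0 (radius lam (m * δ))) = 0} :=
      measurable_pointMeasure hX.measurable (measurableSet_shell _ _) (measurableSet_singleton 0)
    have hle (m : ℕ) : P {ω | ¬ ∃ m : ℕ, pointMeasure X ω (shell 0 (radius lam (m * δ))) ≠ 0}
        ≤ ENNReal.ofReal (Real.exp (-(m * δ))) := by
      rw [← hint m]
      refine (measure_mono (t := {ω | pointMeasure X ω (shell 0 (radius lam (m * δ))) = 0})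
        fun ω hω => ?_).trans ?_
      · by_contra h
        exact hω ⟨m, h⟩
      · rw [← lintegral_indicator_one (hmeas m)]
        refine lintegral_mono fun ω => ?_
        simp only [isVoid, Set.indicator_apply, Set.mem_ofPred_eq, Pi.one_apply]
        exact le_rfl
    have hlim : Tendsto (fun m : ℕ => ENNReal.ofReal (Real.exp (-(m * δ)))) atTop (𝓝 0) := by
      rw [← ENNReal.ofReal_zero]
      refine ENNReal.tendsto_ofReal (Real.tendsto_exp_neg_atTop_nhds_zero.comp ?_)
      exact tendsto_natCast_atTop_atTop.atTop_mul_const hδ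
    exact le_antisymm (ge_of_tendsto' hlim hle) zero_le
  filter_upwards [hzero, hfin, hne] with ω h0 hf hn
  refine ⟨fun k hk => h0 k hk, ?_⟩
  classical
  -- The first nonempty disc has index `n = m + 1`, since the disc of index zero is empty; shell `m`
  -- then holds the closest station.
  set n := Nat.find hn with hn_def
  have hspec := Nat.find_spec hn
  rw [← hn_def] at hspec
  obtain _ | m := n
  · exact absurd ((pointMeasure_eq_zero_iff (measurableSet_shell _ _) ω).2 fun k hk => by
      have := hk.2
      simp only [Nat.cast_zero, zero_mul, radius_zero] at this
      exact absurd this (not_lt.2 (norm_nonneg _))) hspec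
  · have hmin : pointMeasure X ω (shell 0 (radius lam (m * δ))) = 0 := by
      by_contra h
      exact Nat.find_min hn (m := m) (by omega) h
    refine ⟨m, hmin, fun h => hspec ?_, hf m⟩
    rw [pointMeasure_eq_zero_iff (measurableSet_shell _ _)] at hmin h ⊢
    intro k hk
    rcases lt_or_ge ‖X k ω‖ (radius lam (m * δ)) with hlt | hge
    · exact hmin k ⟨hk.1, hlt⟩
    · exact h k ⟨hge, by simpa using hk.2⟩

end

/-! ### The upper bound -/

section

instance (lam : ℝ) : SigmaFinite (intensity lam) :=
  inferInstanceAs (SigmaFinite (lam.toNNReal • (volume : Measure ℂ)))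

variable {Ω : Type*} {X : ℕ → Ω → ℂ}

/-- Success is at least as likely as detection of the one sector that contains the globally closest
station. -/
lemma inv_fadingLaw_success_le {C α Γ : ℝ} (hC : 0 < C) (hα : 0 < α) (hΓ : 0 < Γ) {M : ℕ}
    (x : ℕ → ℂ) (k : ℕ) (i : Fin M) (hk : x k ∈ sector M i) (hmin : ∀ j, ‖x k‖ ≤ ‖x j‖)
    (hk0 : x k ≠ 0) :
    (fadingLaw {f | Success (pathLoss C α) 0 Γ M x f})⁻¹
      ≤ expE (∑' j, logOneAdd (interference α Γ x (sector M i) k j)) := by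
  have hbest : IsBest (pathLoss C α) x (sector M i) k :=
    ⟨hk, fun j _ => (pathLoss_le_iff hC hα (norm_nonneg _) (norm_nonneg _)).2 (hmin j)⟩
  rw [ENNReal.inv_le_iff_inv_le, ← fadingLaw_sinr hC hα hΓ x _ k hbest hk0]
  exact measure_mono fun f hf => ⟨i, k, hbest, hf⟩

/-- Interferers in the serving shell have weight at most `Γ`, since they are no closer than the
server; beyond radius `b` the serving distance is enlarged to `b`. -/
lemma expE_interference_le {α Γ a b : ℝ} (hα : 0 < α) (hΓ : 0 < Γ) {S : Set ℂ}
    (hS : MeasurableSet S) (ω : Ω) (k : ℕ) (hk : X k ω ∈ S ∩ shell a b)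
    (hmin : ∀ j, ‖X k ω‖ ≤ ‖X j ω‖) (hk0 : X k ω ≠ 0) :
    expE (∑' j, logOneAdd (interference α Γ (fun n => X n ω) S k j))
      ≤ countWeight Γ (pointMeasure X ω (S ∩ shell a b)) *
        expE (∫⁻ z, logOneAdd (farField α Γ S b b z) ∂(pointMeasure X ω)) := by
  classical
  have hSm := hS.inter (measurableSet_shell a b)
  set c := ENNReal.ofReal Γ
  have hkn : 0 < ‖X k ω‖ := norm_pos_iff.2 hk0
  have hN : pointMeasure X ω (S ∩ shell a b) ≠ 0 := fun h =>
    (pointMeasure_eq_zero_iff hSm ω).1 h k hk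
  -- The server is counted in its shell but does not interfere. The extra term at `j = k`
  -- compensates for this and becomes the division by `1 + Γ` in `countWeight`.
  have hterm (j : ℕ) : logOneAdd (interference α Γ (fun n => X n ω) S k j) +
      (if j = k then logOneAdd c else 0)
        ≤ logOneAdd c * (S ∩ shell a b).indicator 1 (X j ω) +
          logOneAdd (farField α Γ S b b (X j ω)) := by
    by_cases hjk : j = k
    · subst hjk
      simp [interference, hk]
    by_cases hjS : X j ω ∈ S
    · have hjn := hkn.trans_le (hmin j)
      simp only [interference, hjk, hjS, ne_eq, not_false_eq_true, and_self, if_true, if_false,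
        add_zero]
      rcases lt_or_ge ‖X j ω‖ b with hlt | hge
      · have : X j ω ∈ S ∩ shell a b := ⟨hjS, hk.2.1.trans (hmin j), hlt⟩
        rw [Set.indicator_of_mem this, Pi.one_apply, mul_one]
        refine le_add_right (logOneAdd_mono (ENNReal.ofReal_le_ofReal ?_))
        exact mul_le_of_le_one_right hΓ.le (Real.rpow_le_one (by positivity)
          ((div_le_one hjn).2 (hmin j)) hα.le)
      · refine le_add_left (logOneAdd_mono ?_)
        rw [farField, Set.indicator_of_mem (show X j ω ∈ S ∩ {z | b ≤ ‖z‖} from ⟨hjS, hge⟩)]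
        refine ENNReal.ofReal_le_ofReal ?_
        have := hk.2.2.le
        gcongr
    · simp [interference, hjk, hjS]
  have hsum : ∑' j, logOneAdd (interference α Γ (fun n => X n ω) S k j) + logOneAdd c
      ≤ logOneAdd c * pointMeasure X ω (S ∩ shell a b) +
        ∫⁻ z, logOneAdd (farField α Γ S b b z) ∂(pointMeasure X ω) := by
    rw [pointMeasure_apply X ω hSm, lintegral_pointMeasure X ω
      (g := fun z => logOneAdd (farField α Γ S b b z))
      (measurable_logOneAdd.comp (measurable_farField hS))]
    have h := ENNReal.tsum_le_tsum hterm
    rwa [ENNReal.tsum_add, ENNReal.tsum_add, tsum_ite_eq, ENNReal.tsum_mul_left] at h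
  have hexp := expE_mono hsum
  rw [expE_add, expE_add, expE_logOneAdd] at hexp
  rw [countWeight, if_neg hN, mul_right_comm]
  rwa [← div_eq_mul_inv, ENNReal.le_div_iff_mul_le (by simp) (by simp)]

variable [MeasurableSpace Ω] {P : Measure Ω}

/-- The void disc, the sector slice of the shell (mean count `δ/M`) and the far field occupy
disjoint regions, so the expectation factors. -/
lemma lintegral_term_upper {lam α Γ δ : ℝ} {M : ℕ} (i : Fin M) (hlam : 0 < lam) (hα : 2 < α)
    (hΓ : 0 < Γ) (hδ : 0 < δ) (hX : IsPoissonPointProcess X (intensity lam) P) (m : ℕ) :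
    ∫⁻ ω, isVoid (pointMeasure X ω (shell 0 (radius lam (m * δ)))) *
        countWeight Γ (pointMeasure X ω (sector M i ∩
          shell (radius lam (m * δ)) (radius lam ((m + 1) * δ)))) *
        expE (∫⁻ z, logOneAdd (farField α Γ (sector M i) (radius lam ((m + 1) * δ))
          (radius lam ((m + 1) * δ)) z) ∂(pointMeasure X ω)) ∂P
      = ENNReal.ofReal (Real.exp (-(m * δ)) *
        ((Real.exp (Γ * (δ / M)) - Real.exp (-(δ / M))) / (1 + Γ)) *
        Real.exp (2 * Γ / (α - 2) / M * ((m + 1) * δ))) := by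
  have hM : (0 : ℝ) < M := by exact_mod_cast i.pos
  have hm0 : 0 ≤ m * δ := by positivity
  have hm1 : m * δ ≤ (m + 1) * δ := by gcongr; linarith
  have hα2 : 0 < α - 2 := by linarith
  have hsh : MeasurableSet (sector M i ∩
      shell (radius lam (m * δ)) (radius lam ((m + 1) * δ))) :=
    (measurableSet_sector M i).inter (measurableSet_shell _ _)
  have hρ : 0 < radius lam ((m + 1) * δ) := radius_pos hlam (by positivity)
  have hfar_zero {z : ℂ} (hz : ‖z‖ < radius lam ((m + 1) * δ)) :
      farField α Γ (sector M i) (radius lam ((m + 1) * δ)) (radius lam ((m + 1) * δ)) z = 0 :=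
    Set.indicator_of_notMem (fun h => absurd hz (not_lt.2 h.2)) _
  have hμ : intensity lam (sector M i ∩
      shell (radius lam (m * δ)) (radius lam ((m + 1) * δ))) = ENNReal.ofReal (δ / M) := by
    rw [intensity_sector_shell i hlam (radius_nonneg _ _) (radius_mono hlam hm1), mul_sub,
      mul_radius_sq hlam hm0, mul_radius_sq hlam (hm0.trans hm1)]
    congr 2
    ring
  have hpow : lam * Real.pi * (radius lam ((m + 1) * δ) ^ α * radius lam ((m + 1) * δ) ^ (2 - α))
      = (m + 1) * δ := by
    rw [← Real.rpow_add hρ, add_sub_cancel, Real.rpow_two, mul_radius_sq hlam (hm0.trans hm1)]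
  rw [hX.lintegral_mul_mul_expE (measurableSet_shell _ _) hsh
    ((disjoint_shell _ _ _).mono_right Set.inter_subset_right) measurable_isVoid
    (measurable_countWeight Γ) (measurable_farField (measurableSet_sector M i))
    (fun z hz => hfar_zero (hz.2.trans_le (radius_mono hlam hm1)))
    (fun z hz => hfar_zero hz.2.2),
    hX.lintegral_isVoid (measurableSet_shell _ _)
      (by rw [intensity_disc hlam hm0]; exact ENNReal.ofReal_ne_top),
    hX.lintegral_countWeight hsh (by positivity) hΓ hμ,
    lintegral_farField i hlam hΓ hα hρ.le hρ, intensity_disc hlam hm0, ← ofReal_exp_neg hm0,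
    expE_ofReal (by positivity), hpow, ← ENNReal.ofReal_mul (by positivity),
    ← ENNReal.ofReal_mul]
  · congr 3
    ring
  · refine mul_nonneg (Real.exp_pos _).le (div_nonneg ?_ (by positivity))
    rw [sub_nonneg, Real.exp_le_exp]
    have : 0 < δ / M := by positivity
    nlinarith [mul_pos hΓ this]

/-- The upper bound on the mean number of cycles obtained from shells of mean count `δ`. -/
lemma lintegral_inv_success_le {lam C α Γ δ : ℝ} {M : ℕ} (hlam : 0 < lam) (hC : 0 < C)
    (hα : 2 < α) (hΓ : 0 < Γ) (hδ : 0 < δ) (hM : 2 * Γ / (α - 2) < M)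
    (hX : IsPoissonPointProcess X (intensity lam) P) [IsProbabilityMeasure P] :
    ∫⁻ ω, (fadingLaw {f | Success (pathLoss C α) 0 Γ M (fun k => X k ω) f})⁻¹ ∂P
      ≤ ENNReal.ofReal (M * ((Real.exp (Γ * (δ / M)) - Real.exp (-(δ / M))) / (1 + Γ)) *
        Real.exp (2 * Γ / (α - 2) / M * δ) /
          (1 - Real.exp (-((1 - 2 * Γ / (α - 2) / M) * δ)))) := by
  have hα2 : 0 < α - 2 := by linarith
  have hM0 : (0 : ℝ) < M := lt_of_le_of_lt (by positivity) hM
  have hM0' : 0 < M := by exact_mod_cast hM0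
  set b := 2 * Γ / (α - 2) / M with hb
  have hb1 : b < 1 := by rw [hb, div_lt_one hM0]; exact hM
  set κ := (Real.exp (Γ * (δ / M)) - Real.exp (-(δ / M))) / (1 + Γ) with hκ
  have hκ0 : 0 ≤ κ := by
    refine div_nonneg ?_ (by positivity)
    rw [sub_nonneg, Real.exp_le_exp]
    have : 0 < δ / M := by positivity
    nlinarith [mul_pos hΓ this]
  let T : ℕ → Fin M → Ω → ℝ≥0∞ := fun m i ω =>
    isVoid (pointMeasure X ω (shell 0 (radius lam (m * δ)))) *
      countWeight Γ (pointMeasure X ω (sector M i ∩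
        shell (radius lam (m * δ)) (radius lam ((m + 1) * δ)))) *
      expE (∫⁻ z, logOneAdd (farField α Γ (sector M i) (radius lam ((m + 1) * δ))
        (radius lam ((m + 1) * δ)) z) ∂(pointMeasure X ω))
  have hT (m : ℕ) (i : Fin M) : Measurable (T m i) := by
    refine ((measurable_isVoid.comp (measurable_pointMeasure hX.measurable
      (measurableSet_shell _ _))).mul ((measurable_countWeight Γ).comp (measurable_pointMeasure
        hX.measurable ((measurableSet_sector M i).inter (measurableSet_shell _ _))))).mul
      (measurable_expE.comp (measurable_lintegral_pointMeasure hX.measurable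
        (measurable_logOneAdd.comp (measurable_farField (measurableSet_sector M i)))))
  have hle : ∀ᵐ ω ∂P, (fadingLaw {f | Success (pathLoss C α) 0 Γ M (fun k => X k ω) f})⁻¹
      ≤ ∑' m, ∑ i, T m i ω := by
    filter_upwards [ae_exists_shell hlam hδ hX] with ω ⟨h0, m, hvoid, hne, hfin⟩
    set A := shell (radius lam (m * δ)) (radius lam ((m + 1) * δ)) with hA
    have hAm : MeasurableSet A := measurableSet_shell _ _
    -- Finiteness of the shell count guarantees that a closest station exists.
    have hfinite : {k | X k ω ∈ A}.Finite := by
      have h := ENNReal.finite_const_le_of_tsum_ne_top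
        (a := fun k => A.indicator (1 : ℂ → ℝ≥0∞) (X k ω)) (ε := 1)
        (by rwa [← pointMeasure_apply X ω hAm]) one_ne_zero
      refine h.subset fun k hk => ?_
      simp [Set.indicator_of_mem (show X k ω ∈ A from hk)]
    have hnonempty : {k | X k ω ∈ A}.Nonempty := by
      by_contra h
      rw [Set.not_nonempty_iff_eq_empty] at h
      exact hne ((pointMeasure_eq_zero_iff hAm ω).2 fun k hk => by
        have : k ∈ {k | X k ω ∈ A} := hk
        simp [h] at this)
    obtain ⟨k, hk, hkmin⟩ := hfinite.exists_minimalFor (fun k => ‖X k ω‖) _ hnonempty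
    have hmin (j : ℕ) : ‖X k ω‖ ≤ ‖X j ω‖ := by
      have hj := (pointMeasure_eq_zero_iff (measurableSet_shell _ _) ω).1 hvoid j
      have hj1 : radius lam (m * δ) ≤ ‖X j ω‖ := by
        by_contra hlt
        exact hj ⟨norm_nonneg _, not_le.1 hlt⟩
      rcases lt_or_ge ‖X j ω‖ (radius lam ((m + 1) * δ)) with hlt | hge
      · rcases le_total ‖X k ω‖ ‖X j ω‖ with h | h
        · exact h
        · exact hkmin (show j ∈ {k | X k ω ∈ A} from ⟨hj1, hlt⟩) h
      · exact (show X k ω ∈ A from hk).2.le.trans hge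
    obtain ⟨i, hi⟩ := exists_mem_sector hM0' (X k ω)
    calc _ ≤ _ := inv_fadingLaw_success_le hC (by linarith) hΓ (fun k => X k ω) k i hi hmin (h0 k)
      _ ≤ _ := expE_interference_le (by linarith) hΓ (measurableSet_sector M i) ω k ⟨hi, hk⟩
          hmin (h0 k)
      _ = T m i ω := by simp only [T, hvoid, isVoid, if_true, one_mul]
      -- The sector of the server is random, so all `M` are summed; this factor `M` offsets the
      -- slice mean `δ/M`.
      _ ≤ ∑ i, T m i ω := Finset.single_le_sum (f := fun i => T m i ω) (fun _ _ => zero_le)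
          (Finset.mem_univ i)
      _ ≤ _ := ENNReal.le_tsum m
  refine (lintegral_mono_ae hle).trans_eq ?_
  rw [lintegral_tsum fun m => (Finset.measurable_fun_sum _ fun i _ => hT m i).aemeasurable]
  -- The void probability `exp(-mδ)` against the far field `exp(b(m+1)δ)` leaves a geometric series
  -- of ratio `exp(-(1-b)δ)`, convergent because `b < 1`.
  have hterm (m : ℕ) : ∫⁻ ω, ∑ i, T m i ω ∂P
      = ENNReal.ofReal (M * κ * Real.exp (b * δ) * Real.exp (-((1 - b) * δ)) ^ m) := by
    rw [lintegral_finsetSum _ fun i _ => hT m i,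
      Finset.sum_congr rfl fun i _ => lintegral_term_upper i hlam hα hΓ hδ hX m,
      Finset.sum_const, Finset.card_univ, Fintype.card_fin, nsmul_eq_mul,
      ← ENNReal.ofReal_natCast, ← ENNReal.ofReal_mul (by positivity)]
    congr 1
    rw [← hb, ← hκ, ← Real.exp_nat_mul]
    have : Real.exp (-(m * δ)) * Real.exp (b * ((m + 1) * δ))
        = Real.exp (b * δ) * Real.exp (m * -((1 - b) * δ)) := by
      rw [← Real.exp_add, ← Real.exp_add]
      congr 1
      ring
    linear_combination (M * κ) * this
  have hr1 : Real.exp (-((1 - b) * δ)) < 1 :=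
    Real.exp_lt_one_iff.2 (neg_neg_of_pos (mul_pos (by linarith) hδ))
  simp_rw [hterm]
  rw [← ENNReal.ofReal_tsum_of_nonneg (fun m => by positivity)
    ((summable_geometric_of_lt_one (Real.exp_pos _).le hr1).mul_left _), tsum_mul_left,
    tsum_geometric_of_lt_one (Real.exp_pos _).le hr1, div_eq_mul_inv]

lemma tendsto_sub_div_of_hasDerivAt {f : ℝ → ℝ} {f' : ℝ} (hf : HasDerivAt f f' 0)
    (h0 : f 0 = 0) : Tendsto (fun δ => f δ / δ) (𝓝[>] 0) (𝓝 f') := by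
  have := hf.tendsto_slope_zero_right
  simpa [h0, div_eq_inv_mul] using this

/-- Numerator and denominator vanish at `δ = 0` with derivatives `1` and `1 - b`. -/
lemma tendsto_shellBound {Γ M b : ℝ} (hΓ : 0 < Γ) (hM : 0 < M) (hb : b < 1) :
    Tendsto (fun δ : ℝ => M * ((Real.exp (Γ * (δ / M)) - Real.exp (-(δ / M))) / (1 + Γ)) *
        Real.exp (b * δ) / (1 - Real.exp (-((1 - b) * δ)))) (𝓝[>] 0) (𝓝 (1 / (1 - b))) := by
  have h1 : HasDerivAt (fun δ : ℝ => M * ((Real.exp (Γ * (δ / M)) - Real.exp (-(δ / M))) / (1 + Γ)) *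
        Real.exp (b * δ)) 1 0 := by
    have e1 : HasDerivAt (fun δ : ℝ => Real.exp (Γ * (δ / M))) (Γ / M) 0 :=
      (((hasDerivAt_id (0 : ℝ)).div_const M).const_mul Γ).exp.congr_deriv
        (by simp [div_eq_mul_inv])
    have e2 : HasDerivAt (fun δ : ℝ => Real.exp (-(δ / M))) (-(1 / M)) 0 :=
      ((hasDerivAt_id (0 : ℝ)).div_const M).neg.exp.congr_deriv (by simp)
    have e3 : HasDerivAt (fun δ : ℝ => Real.exp (b * δ)) b 0 :=
      ((hasDerivAt_id (0 : ℝ)).const_mul b).exp.congr_deriv (by simp)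
    refine ((((e1.sub e2).div_const (1 + Γ)).const_mul M).mul e3).congr_deriv ?_
    simp
    field_simp
    ring
  have h2 : HasDerivAt (fun δ : ℝ => 1 - Real.exp (-((1 - b) * δ))) (1 - b) 0 :=
    (((hasDerivAt_id (0 : ℝ)).const_mul (1 - b)).neg.exp.const_sub 1).congr_deriv (by simp)
  have h := (tendsto_sub_div_of_hasDerivAt h1 (by simp)).div
    (tendsto_sub_div_of_hasDerivAt h2 (by simp)) (by linarith)
  refine h.congr' ?_
  filter_upwards [self_mem_nhdsWithin] with δ hδ
  have hδ' : δ ≠ 0 := ne_of_gt hδ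
  simp only [Pi.div_apply]
  field_simp

lemma lintegral_inv_success_le_limit {lam C α Γ : ℝ} {M : ℕ} (hlam : 0 < lam) (hC : 0 < C)
    (hα : 2 < α) (hΓ : 0 < Γ) (hM : 2 * Γ / (α - 2) < M)
    (hX : IsPoissonPointProcess X (intensity lam) P) [IsProbabilityMeasure P] :
    ∫⁻ ω, (fadingLaw {f | Success (pathLoss C α) 0 Γ M (fun k => X k ω) f})⁻¹ ∂P
      ≤ ENNReal.ofReal (M * (α - 2) / (M * (α - 2) - 2 * Γ)) := by
  have hα2 : 0 < α - 2 := by linarith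
  have hM0 : (0 : ℝ) < M := lt_of_le_of_lt (by positivity) hM
  have hb1 : 2 * Γ / (α - 2) / M < 1 := by rw [div_lt_one hM0]; exact hM
  have hval : M * (α - 2) / (M * (α - 2) - 2 * Γ) = 1 / (1 - 2 * Γ / (α - 2) / M) := by
    rw [div_lt_iff₀ hα2] at hM
    have h1 : M * (α - 2) - 2 * Γ ≠ 0 := by linarith
    have h2 : 1 - 2 * Γ / (α - 2) / M ≠ 0 := by linarith
    field_simp
  rw [hval]
  refine ge_of_tendsto (ENNReal.tendsto_ofReal (tendsto_shellBound hΓ hM0 hb1)) ?_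
  filter_upwards [self_mem_nhdsWithin] with δ hδ
  exact lintegral_inv_success_le hlam hC hα hΓ hδ hM hX

end

/-! ### The lower bound -/

section

/-- If the closest station is alone in its shell, then the mean waiting time is bounded below by the
generating functional of the stations outside the shell. -/
lemma expE_farField_le_inv {Ω : Type*} {X : ℕ → Ω → ℂ} {C α Γ a b : ℝ} (hC : 0 < C) (hα : 0 < α)
    (hΓ : 0 < Γ) (ha : 0 < a) (ω : Ω) (hvoid : pointMeasure X ω (shell 0 a) = 0)
    (hone : pointMeasure X ω (shell a b) = 1) :
    expE (∫⁻ z, logOneAdd (farField α Γ Set.univ a b z) ∂(pointMeasure X ω))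
      ≤ (fadingLaw {f | Success (pathLoss C α) 0 Γ 1 (fun k => X k ω) f})⁻¹ := by
  classical
  have hle (j : ℕ) : a ≤ ‖X j ω‖ := by
    by_contra hlt
    exact (pointMeasure_eq_zero_iff (measurableSet_shell _ _) ω).1 hvoid j
      ⟨norm_nonneg _, not_le.1 hlt⟩
  obtain ⟨k, hk⟩ : ∃ k, X k ω ∈ shell a b := by
    by_contra! h
    rw [(pointMeasure_eq_zero_iff (measurableSet_shell _ _) ω).2 h] at hone
    exact zero_ne_one hone
  -- `Detected` allows any best index; uniqueness in the shell rules out ties and so identifies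
  -- success with detection through `k`.
  have huniq (j : ℕ) (hj : X j ω ∈ shell a b) : j = k := by
    by_contra hjk
    have h := ENNReal.sum_le_tsum (f := fun n => (shell a b).indicator (1 : ℂ → ℝ≥0∞) (X n ω))
      {j, k}
    rw [← pointMeasure_apply X ω (measurableSet_shell a b), hone, Finset.sum_pair hjk,
      Set.indicator_of_mem hj, Set.indicator_of_mem hk, Pi.one_apply, Pi.one_apply] at h
    norm_num at h
  have hfar (j : ℕ) (hjk : j ≠ k) : b ≤ ‖X j ω‖ := by
    by_contra hlt
    exact hjk (huniq j ⟨hle j, not_le.1 hlt⟩)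
  have hmin (j : ℕ) : ‖X k ω‖ ≤ ‖X j ω‖ := by
    by_cases hjk : j = k
    · rw [hjk]
    · exact hk.2.le.trans (hfar j hjk)
  have hkpos : 0 < ‖X k ω‖ := ha.trans_le (hle k)
  have hbest : IsBest (pathLoss C α) (fun n => X n ω) Set.univ k :=
    ⟨trivial, fun j _ => (pathLoss_le_iff hC hα (norm_nonneg _) (norm_nonneg _)).2 (hmin j)⟩
  have hsub : {f | Success (pathLoss C α) 0 Γ 1 (fun n => X n ω) f}
      ⊆ {f | ENNReal.ofReal Γ < sinr (pathLoss C α) 0 (fun n => X n ω) f Set.univ k} := by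
    rintro f ⟨i, k', hk', hf⟩
    rw [sector_one] at hk' hf
    have h := (pathLoss_le_iff hC hα (norm_nonneg _) (norm_nonneg _)).1 (hk'.2 k trivial)
    obtain rfl : k' = k := huniq k' ⟨hle k', h.trans_lt hk.2⟩
    exact hf
  rw [ENNReal.le_inv_iff_le_inv]
  refine (measure_mono hsub).trans ?_
  rw [fadingLaw_sinr hC hα hΓ _ _ k hbest (norm_pos_iff.1 hkpos), ENNReal.inv_le_inv,
    lintegral_pointMeasure X ω (g := fun z => logOneAdd (farField α Γ Set.univ a b z))
      (measurable_logOneAdd.comp (measurable_farField .univ))]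
  -- Replacing the serving distance by its lower bound `a` only decreases the weights.
  refine expE_mono (ENNReal.tsum_le_tsum fun j => logOneAdd_mono ?_)
  by_cases hjk : j = k
  · subst hjk
    rw [farField, Set.indicator_of_notMem fun h => absurd hk.2 (not_lt.2 h.2)]
    exact zero_le
  · rw [farField, Set.indicator_of_mem (show X j ω ∈ Set.univ ∩ {z | b ≤ ‖z‖} from
      ⟨trivial, hfar j hjk⟩), interference, if_pos ⟨hjk, trivial⟩]
    refine ENNReal.ofReal_le_ofReal ?_
    have := hle k
    gcongr

/-- From `log(1 + 1/m) ≤ 1/m` and `exp x ≥ 1 + x`. With `s = α/2 - 1` it shows that the gap between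
the two shell radii costs only a constant in the exponent, uniformly in `m`. -/
lemma sub_le_mul_rpow {m s : ℝ} (hm : 0 < m) (hs : 0 < s) :
    m - s ≤ m * (m / (m + 1)) ^ s := by
  have h1 : 1 - s / m ≤ (m / (m + 1)) ^ s := by
    have hlog : -(1 / m) ≤ Real.log (m / (m + 1)) := by
      rw [← inv_div (m + 1) m, Real.log_inv, neg_le_neg_iff]
      refine (Real.log_le_sub_one_of_pos (by positivity)).trans_eq ?_
      field_simp
      ring
    rw [Real.rpow_def_of_pos (by positivity)]
    refine le_trans ?_ (Real.add_one_le_exp _)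
    have := mul_le_mul_of_nonneg_right hlog hs.le
    have h2 : -(1 / m) * s = -(s / m) := by ring
    linarith
  calc m - s = m * (1 - s / m) := by field_simp
    _ ≤ _ := by gcongr

variable {Ω : Type*} [MeasurableSpace Ω] {P : Measure Ω} {X : ℕ → Ω → ℂ}

/-- The exponent is `-m - 1 + (2Γ/(α-2)) m (m/(m+1))^(α/2-1)`. As `2Γ/(α-2) ≥ 1`, it is at least `-m
- 1 + m - (α/2 - 1) = -α/2`. -/
lemma lintegral_term_lower {lam α Γ : ℝ} (hlam : 0 < lam) (hα : 2 < α) (hΓ : 0 < Γ)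
    (hle : α ≤ 2 * Γ + 2) (hX : IsPoissonPointProcess X (intensity lam) P) {m : ℝ} (hm : 0 < m) :
    ENNReal.ofReal (Real.exp (-(α / 2))) ≤
      ∫⁻ ω, isVoid (pointMeasure X ω (shell 0 (radius lam m))) *
        isSingle (pointMeasure X ω (shell (radius lam m) (radius lam (m + 1)))) *
        expE (∫⁻ z, logOneAdd (farField α Γ Set.univ (radius lam m) (radius lam (m + 1)) z)
          ∂(pointMeasure X ω)) ∂P := by
  have hα2 : 0 < α - 2 := by linarith
  have hm1 : m ≤ m + 1 := by linarith
  have hρ : 0 < radius lam m := radius_pos hlam hm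
  have hρ1 : 0 < radius lam (m + 1) := radius_pos hlam (by linarith)
  have hfar_zero {z : ℂ} (hz : ‖z‖ < radius lam (m + 1)) :
      farField α Γ Set.univ (radius lam m) (radius lam (m + 1)) z = 0 :=
    Set.indicator_of_notMem (fun h => absurd hz (not_lt.2 h.2)) _
  have hμ : intensity lam (shell (radius lam m) (radius lam (m + 1))) = ENNReal.ofReal 1 := by
    rw [intensity_shell_radius hlam hm.le hm1]
    simp
  have hint := lintegral_farField (0 : Fin 1) hlam hΓ hα hρ.le hρ1
  rw [sector_one] at hint
  have hratio : radius lam m / radius lam (m + 1) = (m / (m + 1)) ^ (1 / 2 : ℝ) := by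
    have := Real.pi_pos
    rw [radius, radius, ← Real.sqrt_div (by positivity), ← Real.sqrt_eq_rpow]
    congr 1
    field_simp
  have hpow : lam * Real.pi * (radius lam m ^ α * radius lam (m + 1) ^ (2 - α))
      = m * (m / (m + 1)) ^ (α / 2 - 1) := by
    have h1 : radius lam m ^ α = radius lam m ^ 2 * radius lam m ^ (α - 2) := by
      rw [← Real.rpow_two, ← Real.rpow_add hρ, add_sub_cancel]
    have h2 : radius lam (m + 1) ^ (2 - α) = (radius lam (m + 1) ^ (α - 2))⁻¹ := by
      rw [← Real.rpow_neg hρ1.le, neg_sub]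
    calc _ = lam * Real.pi * radius lam m ^ 2 *
          (radius lam m ^ (α - 2) / radius lam (m + 1) ^ (α - 2)) := by rw [h1, h2]; ring
      _ = _ := by
        rw [mul_radius_sq hlam hm.le, ← Real.div_rpow hρ.le hρ1.le, hratio,
          ← Real.rpow_mul (by positivity)]
        congr 2
        ring
  rw [hX.lintegral_mul_mul_expE (measurableSet_shell _ _) (measurableSet_shell _ _)
    (disjoint_shell _ _ _) measurable_isVoid measurable_isSingle (measurable_farField .univ)
    (fun z hz => hfar_zero (hz.2.trans_le (radius_mono hlam hm1)))
    (fun z hz => hfar_zero hz.2),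
    hX.lintegral_isVoid (measurableSet_shell _ _)
      (by rw [intensity_disc hlam hm.le]; exact ENNReal.ofReal_ne_top),
    hX.lintegral_isSingle (measurableSet_shell _ _) (by rw [hμ]; exact ENNReal.ofReal_ne_top),
    hint, intensity_disc hlam hm.le, hμ, hpow, ← ofReal_exp_neg hm.le,
    ← ofReal_exp_neg zero_le_one, ENNReal.ofReal_one, mul_one, expE_ofReal (by positivity),
    ← ENNReal.ofReal_mul (by positivity), ← ENNReal.ofReal_mul (by positivity),
    ← Real.exp_add, ← Real.exp_add]
  refine ENNReal.ofReal_le_ofReal (Real.exp_le_exp.2 ?_)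
  have h1 := sub_le_mul_rpow hm (show 0 < α / 2 - 1 by linarith)
  have h2 : 1 ≤ 2 * Γ / (α - 2) := by rw [le_div_iff₀ hα2]; linarith
  have h3 : 0 ≤ m * (m / (m + 1)) ^ (α / 2 - 1) := by positivity
  have h4 := le_mul_of_one_le_left h3 h2
  simp only [Nat.cast_one, div_one]
  linarith

lemma lintegral_inv_success_eq_top {lam C α Γ : ℝ} (hlam : 0 < lam) (hC : 0 < C) (hα : 2 < α)
    (hΓ : 0 < Γ) (hle : α ≤ 2 * Γ + 2) (hX : IsPoissonPointProcess X (intensity lam) P) :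
    ∫⁻ ω, (fadingLaw {f | Success (pathLoss C α) 0 Γ 1 (fun k => X k ω) f})⁻¹ ∂P = ∞ := by
  -- Shells start at `m + 1`, so that the inner radius is positive.
  let T : ℕ → Ω → ℝ≥0∞ := fun m ω =>
    isVoid (pointMeasure X ω (shell 0 (radius lam (m + 1)))) *
      isSingle (pointMeasure X ω (shell (radius lam (m + 1)) (radius lam (m + 1 + 1)))) *
      expE (∫⁻ z, logOneAdd (farField α Γ Set.univ (radius lam (m + 1)) (radius lam (m + 1 + 1)) z)
        ∂(pointMeasure X ω))
  have hT (m : ℕ) : Measurable (T m) := by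
    refine ((measurable_isVoid.comp (measurable_pointMeasure hX.measurable
      (measurableSet_shell _ _))).mul (measurable_isSingle.comp (measurable_pointMeasure
        hX.measurable (measurableSet_shell _ _)))).mul
      (measurable_expE.comp (measurable_lintegral_pointMeasure hX.measurable
        (measurable_logOneAdd.comp (measurable_farField .univ))))
  have hT0 (m : ℕ) (ω : Ω) (h : T m ω ≠ 0) :
      pointMeasure X ω (shell 0 (radius lam (m + 1))) = 0 ∧
      pointMeasure X ω (shell (radius lam (m + 1)) (radius lam (m + 1 + 1))) = 1 := by
    constructor
    · by_contra h'
      exact h (by simp [T, isVoid, h'])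
    · by_contra h'
      exact h (by simp [T, isSingle, h'])
  -- A single station in shell `m` contradicts an empty disc for `n > m`. At most one `T m ω` is
  -- therefore nonzero, and the whole sum stays below `1/p`.
  have hlt {m n : ℕ} {ω : Ω} (hm : T m ω ≠ 0) (hn : T n ω ≠ 0) : ¬ m < n := by
    intro hmn
    have hsub : shell (radius lam (m + 1)) (radius lam (m + 1 + 1))
        ⊆ shell 0 (radius lam (n + 1)) := fun z hz =>
      ⟨norm_nonneg _, hz.2.trans_le (radius_mono hlam (by
        have : (m : ℝ) + 1 ≤ n := by exact_mod_cast hmn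
        linarith))⟩
    have h := measure_mono (μ := pointMeasure X ω) hsub
    rw [(hT0 m ω hm).2, (hT0 n ω hn).1] at h
    exact absurd h (by simp)
  have hbound (ω : Ω) : ∑' m, T m ω
      ≤ (fadingLaw {f | Success (pathLoss C α) 0 Γ 1 (fun k => X k ω) f})⁻¹ := by
    by_cases h : ∃ m, T m ω ≠ 0
    · obtain ⟨m, hm⟩ := h
      rw [tsum_eq_single m fun n hn => by
        by_contra h'
        rcases lt_or_gt_of_ne hn with h | h
        exacts [hlt h' hm h, hlt hm h' h]]
      obtain ⟨h1, h2⟩ := hT0 m ω hm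
      simp only [T, h1, h2, isVoid, isSingle, if_true, one_mul]
      exact expE_farField_le_inv hC (by linarith) hΓ (radius_pos hlam (by positivity)) ω h1 h2
    · push Not at h
      simp [h]
  refine eq_top_iff.2 (le_trans ?_ (lintegral_mono hbound))
  rw [lintegral_tsum fun m => (hT m).aemeasurable]
  calc ∞ = ∑' _ : ℕ, ENNReal.ofReal (Real.exp (-(α / 2))) :=
        (ENNReal.tsum_const_eq_top_of_ne_zero (by simpa using Real.exp_pos _)).symm
    _ ≤ _ := ENNReal.tsum_le_tsum fun m =>
        lintegral_term_lower hlam hα hΓ hle hX (by positivity)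

end

end

end CellSearch


theorem mainTheorem5 {Ω : Type*} [MeasurableSpace Ω] (P : Measure Ω) [IsProbabilityMeasure P]
    (X : ℕ → Ω → ℂ) (F : ℕ → ℕ → Ω → ℝ) (lam C α Γ : ℝ)
    (hlam : 0 < lam) (hC : 0 < C) (hα : 2 < α) (hΓ : 0 < Γ)
    (hX : CellSearch.IsPoissonPointProcess X (ENNReal.ofReal lam • (volume : Measure ℂ)) P)
    (hF : CellSearch.IsRayleighFading F P)
    (hXF : IndepFun (fun ω (k : ℕ) => X k ω) (fun ω (p : ℕ × ℕ) => F p.1 p.2 ω) P) :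
    (∀ M : ℕ, 2 * Γ / (α - 2) < (M : ℝ) →
      CellSearch.meanCycles P X F C α Γ M < ∞ ∧
      CellSearch.meanCycles P X F C α Γ M ≤
        ENNReal.ofReal (M * (α - 2) / (M * (α - 2) - 2 * Γ))) ∧
    (CellSearch.meanCycles P X F C α Γ 1 < ∞ ↔ 2 * Γ + 2 < α) := by
  have hmean := CellSearch.meanCycles_eq P X F C α Γ hX.measurable hF hXF
  have hupper (M : ℕ) (hM : 2 * Γ / (α - 2) < (M : ℝ)) :
      CellSearch.meanCycles P X F C α Γ M ≤
        ENNReal.ofReal (M * (α - 2) / (M * (α - 2) - 2 * Γ)) :=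
    (hmean M).trans_le (CellSearch.lintegral_inv_success_le_limit hlam hC hα hΓ hM hX)
  have hupper' (M : ℕ) (hM : 2 * Γ / (α - 2) < (M : ℝ)) :
      CellSearch.meanCycles P X F C α Γ M < ∞ := (hupper M hM).trans_lt ENNReal.ofReal_lt_top
  refine ⟨fun M hM => ⟨hupper' M hM, hupper M hM⟩, fun h => ?_, fun h => hupper' 1 ?_⟩
  · by_contra! hle
    rw [hmean, CellSearch.lintegral_inv_success_eq_top hlam hC hα hΓ hle hX] at h
    exact lt_irrefl _ h
  · rw [div_lt_iff₀ (by linarith)]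
    norm_num
    linarith
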